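/- For $l,h>0$ let $C(l,h)=\{x\in\mathbb R^3: x_1^2+x_2^2<l^2,\ |x_3|<h\}$, and for bounded $K\subset\mathbb R^3$ let \[ \operatorname{Cap}(K,\mathbb R^3)=\inf\Big\{\int_{\mathbb R^3}|\nabla v|^2\,dx : v\in C_c^\infty(\mathbb R^3),\ K\subset\operatorname{int}(\{v=1\})\Big\}. \] For $U\subset\mathbb R^3$ open and $v\in H^1(U)$, say that $v=1$ weakly on a bounded set $K\subset\mathbb R^3$ if there exist an open neighbourhood $W$ of the closure $\overline K$ and functions $w_n\in C^\infty(U\cap W)$ such that $\|w_n-(v-1)\|_{H^1(U\cap W)}\to 0$ and $K\cap\overline{\operatorname{supp}(w_n)}=\emptyset$ for all $n$, where the outer closure is taken in $\mathbb R^3$. Let $K\subset\mathbb R^3$ be bounded and let $\theta\in(0,1)$. Then there exist positive constants $L,H,\tau,c$ (depending only on $K$ and $\theta$) such that, whenever \[ l\ge L,\qquad h\ge H,\qquad \max\Big\{\frac{\ln l}{h},\frac{h}{l^2}\Big\}\le\tau, \] and $v\in H^1(C(l,h))$ satisfies \[ v=1\ \text{weakly on } K,\qquad \int_{C(l,h)}|\nabla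 v|^2\,dx<\theta\operatorname{Cap}(K,\mathbb R^3), \] one has \[ \frac1{|C(l,h)|}\int_{C(l,h)}v\,dx>c . \] -/

import Mathlib

open MeasureTheory Filter Topology Set
open scoped ContDiff Gradient

/-- `g` is the weak (distributional) gradient of `v` on the open set `U`. -/
def HasWeakGradient {N : ℕ} (U : Set (EuclideanSpace ℝ (Fin N)))
    (v : EuclideanSpace ℝ (Fin N) → ℝ)
    (g : EuclideanSpace ℝ (Fin N) → EuclideanSpace ℝ (Fin N)) : Prop :=
  LocallyIntegrableOn v U ∧ LocallyIntegrableOn g U ∧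
    ∀ φ : EuclideanSpace ℝ (Fin N) → ℝ, ContDiff ℝ ∞ φ → HasCompactSupport φ → tsupport φ ⊆ U →
      ∫ x in U, v x • ∇ φ x = - ∫ x in U, φ x • g x

/-- `v` belongs to the Sobolev space `H¹(U)`, with weak gradient `g`. -/
structure IsSobolevH1 {N : ℕ} (U : Set (EuclideanSpace ℝ (Fin N)))
    (v : EuclideanSpace ℝ (Fin N) → ℝ)
    (g : EuclideanSpace ℝ (Fin N) → EuclideanSpace ℝ (Fin N)) : Prop where
  memLp : MemLp v 2 (volume.restrict U)
  memLp_grad : MemLp g 2 (volume.restrict U)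
  hasWeakGradient : HasWeakGradient U v g

/-- A function `v` on `U` with weak gradient `g` vanishes weakly on `A`: on a neighbourhood `W`
of the closure of `A` it is the limit, in `H¹(U ∩ W)`, of smooth functions `w n` on `U ∩ W` such
that the closure (in the whole space) of the support of `w n` does not meet `A`. -/
def VanishesWeakly {N : ℕ} (U : Set (EuclideanSpace ℝ (Fin N)))
    (v : EuclideanSpace ℝ (Fin N) → ℝ)
    (g : EuclideanSpace ℝ (Fin N) → EuclideanSpace ℝ (Fin N))
    (A : Set (EuclideanSpace ℝ (Fin N))) : Prop :=
  ∃ W : Set (EuclideanSpace ℝ (Fin N)), IsOpen W ∧ closure A ⊆ W ∧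
    ∃ w : ℕ → EuclideanSpace ℝ (Fin N) → ℝ,
      (∀ n, ContDiffOn ℝ ∞ (w n) (U ∩ W)) ∧
      (∀ n, A ∩ closure {x | x ∈ U ∩ W ∧ w n x ≠ 0} = ∅) ∧
      Tendsto (fun n => eLpNorm (fun x => w n x - v x) 2 (volume.restrict (U ∩ W))) atTop (𝓝 0) ∧
      Tendsto (fun n => eLpNorm (fun x => ∇ (w n) x - g x) 2 (volume.restrict (U ∩ W)))
        atTop (𝓝 0)

/-- `v = a` weakly on `A`, where `v` is a function on `U` with weak gradient `g`. -/
def EqWeakly {N : ℕ} (U : Set (EuclideanSpace ℝ (Fin N)))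
    (v : EuclideanSpace ℝ (Fin N) → ℝ)
    (g : EuclideanSpace ℝ (Fin N) → EuclideanSpace ℝ (Fin N)) (a : ℝ)
    (A : Set (EuclideanSpace ℝ (Fin N))) : Prop :=
  VanishesWeakly U (fun x => v x - a) g A

/-- The classical harmonic capacity of a bounded set `K` relative to an open set `U`
containing its closure. -/
noncomputable def harmonicCapacity {N : ℕ} (K U : Set (EuclideanSpace ℝ (Fin N))) : ℝ :=
  sInf {E : ℝ | ∃ v : EuclideanSpace ℝ (Fin N) → ℝ,
    ContDiff ℝ ∞ v ∧ HasCompactSupport v ∧ tsupport v ⊆ U ∧ K ⊆ interior {x | v x = 1} ∧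
      E = ∫ x in U, ‖∇ v x‖ ^ 2}

/-- The open cylinder `B'(0, l) × (-h, h)` in `ℝ³` (for `l, h > 0`). -/
def solidCylinder (l h : ℝ) : Set (EuclideanSpace ℝ (Fin 3)) :=
  {x | x 0 ^ 2 + x 1 ^ 2 < l ^ 2 ∧ -h < x 2 ∧ x 2 < h}

open scoped ENNReal

/-! Write U for the cylinder C(l,h), g for the weak gradient and m for the average of v over U, and
suppose that m ≤ ε with ε = (1 - √θ)/2. If η is a compactly supported cutoff in U, equal to 1 near
the closure of K, then η(v - m) equals 1 - m weakly on K and is, up to scaling and smoothing, a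
competitor for the capacity. Hence (1 - m)² Cap(K) ≤ ‖η g + (v - m)∇η‖² in L²(U)
(`IsSobolevH1.ofReal_mul_harmonicCapacity_le`). If the cutoff error (v - m)∇η has norm at most ε‖g‖,
the right side is at most (1 + ε)²∫|g|² < (1 + ε)²θ Cap(K). Since (1 + ε)√θ ≤ 1 - ε ≤ 1 - m, this is
a contradiction.

The error is controlled by a Poincaré inequality in which the average is taken over all of U while
the constant ignores l and h: ∫_{C(S,S)} |v - m|² ≤ 536 S² ∫_U |g|²
(`IsSobolevH1.setLIntegral_sub_average_sq_le`). A cutoff at one scale S has |∇η|² of order S⁻², so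
its error is bounded but not small. Averaging n cutoffs that vary on disjoint annuli
(`exists_multiscale_cutoff`) makes |∇η|² at most n⁻² times a sum of n such terms, and the squared
error becomes O(1/n)∫|g|².

For the Poincaré inequality, a point x is joined to its image under a linear stretch by the factor
A. Stretching d coordinates costs a factor ∫_1^A a^{-(d-1)} da (`setLIntegral_sub_stretch_sq_le`),
which is bounded for d = 3, log A for d = 2 and linear in A for d = 1. The cylinder C(S,S) is
dilated to C(m',m') with m' = min(l,h), then stretched horizontally or vertically to U. After
normalising by volume the last stretch costs S³ log(l/h)/(2h) or S³h/(2l²). Both are at most S² when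
(ln l)/h and h/l² are small, which is the origin of the condition on these two ratios. -/

theorem sq_lintegral_mul_le {α : Type*} [MeasurableSpace α] (μ : Measure α) {f g : α → ℝ≥0∞}
    (hf : AEMeasurable f μ) (hg : AEMeasurable g μ) :
    (∫⁻ a, f a * g a ∂μ) ^ 2 ≤ (∫⁻ a, f a ^ 2 ∂μ) * ∫⁻ a, g a ^ 2 ∂μ := by
  have h := ENNReal.lintegral_mul_le_Lp_mul_Lq μ (Real.HolderConjugate.two_two) hf hg
  simp only [Pi.mul_apply, ENNReal.rpow_two] at h
  calc _ ≤ ((∫⁻ a, f a ^ 2 ∂μ) ^ (1 / 2 : ℝ) * (∫⁻ a, g a ^ 2 ∂μ) ^ (1 / 2 : ℝ)) ^ 2 := by gcongr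
    _ = _ := by
      rw [mul_pow, ← ENNReal.rpow_natCast, ← ENNReal.rpow_natCast, ← ENNReal.rpow_mul,
        ← ENNReal.rpow_mul]
      norm_num

/-! ### Comparing a function with its values after a linear stretch -/

section Flow

variable {E : Type*} [NormedAddCommGroup E] [NormedSpace ℝ E]

/-- The linear map that stretches the range of the projection `P` by the factor `a`. -/
noncomputable def stretch (P : E →L[ℝ] E) (a : ℝ) : E →L[ℝ] E :=
  ContinuousLinearMap.id ℝ E + (a - 1) • P

theorem stretch_apply (P : E →L[ℝ] E) (a : ℝ) (x : E) : stretch P a x = x + (a - 1) • P x := by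
  simp [stretch]

/-- The increment is the integral of the derivative along a ↦ `stretch P a x`, whose velocity is P
x; Cauchy–Schwarz is applied with weight a^k. The weight is meant to pair with a Jacobian a^(k+1),
so that after the change of variables the remaining power of a does not depend on k. -/
theorem enorm_sub_stretch_sq_le (P : E →L[ℝ] E) {u : E → ℝ} (hu : ContDiff ℝ 1 u) (k : ℕ) {A : ℝ}
    (hA : 1 ≤ A) (x : E) :
    ‖u x - u (stretch P A x)‖ₑ ^ 2 ≤
      (∫⁻ a in Ioc 1 A, ENNReal.ofReal (a ^ k)⁻¹) *
        ∫⁻ a in Ioc 1 A,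
          ENNReal.ofReal (a ^ k) * (‖fderiv ℝ u (stretch P a x)‖ₑ ^ 2 * ‖P x‖ₑ ^ 2) := by
  have hcont : Continuous fun a : ℝ => stretch P a x := by
    simp only [stretch_apply]; fun_prop
  have hfd : Continuous fun a : ℝ => fderiv ℝ u (stretch P a x) :=
    (hu.continuous_fderiv (by simp)).comp hcont
  have hder : ∀ a : ℝ, HasDerivAt (fun a => u (stretch P a x)) (fderiv ℝ u (stretch P a x) (P x)) a := by
    intro a
    have h1 : HasDerivAt (fun a : ℝ => stretch P a x) (P x) a := by
      simp only [stretch_apply]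
      simpa using (((hasDerivAt_id a).sub_const 1).smul_const (P x)).const_add x
    exact ((hu.differentiable (by simp)) _).hasFDerivAt.comp_hasDerivAt a h1
  have hint : ∫ a in (1 : ℝ)..A, fderiv ℝ u (stretch P a x) (P x) = u (stretch P A x) - u x := by
    rw [intervalIntegral.integral_eq_sub_of_hasDerivAt (fun a _ => hder a)
      ((hfd.clm_apply continuous_const).intervalIntegrable _ _)]
    simp [stretch_apply]
  have h1 : ‖u x - u (stretch P A x)‖ₑ ≤
      ∫⁻ a in Ioc 1 A, ENNReal.ofReal (Real.sqrt (a ^ k)⁻¹) *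
        (ENNReal.ofReal (Real.sqrt (a ^ k)) * (‖fderiv ℝ u (stretch P a x)‖ₑ * ‖P x‖ₑ)) := by
    rw [← enorm_neg, neg_sub, ← hint, intervalIntegral.integral_of_le hA]
    refine (enorm_integral_le_lintegral_enorm _).trans (setLIntegral_mono' measurableSet_Ioc ?_)
    intro a ha
    have ha0 : (0 : ℝ) < a ^ k := pow_pos (by linarith [ha.1]) _
    rw [← mul_assoc, ← ENNReal.ofReal_mul (by positivity), ← Real.sqrt_mul (by positivity),
      inv_mul_cancel₀ ha0.ne']
    simpa using (fderiv ℝ u (stretch P a x)).le_opENorm (P x)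
  calc _ ≤ _ := by gcongr
    _ ≤ _ := sq_lintegral_mul_le _ (by fun_prop) (Measurable.aemeasurable (by
      have := hfd.enorm.measurable
      fun_prop))
    _ = _ := by
      congr 1
      · refine setLIntegral_congr_fun measurableSet_Ioc fun a ha => ?_
        have ha0 : (0 : ℝ) < a ^ k := pow_pos (by linarith [ha.1]) _
        rw [← ENNReal.ofReal_pow (by positivity), Real.sq_sqrt (by positivity)]
      · refine setLIntegral_congr_fun measurableSet_Ioc fun a ha => ?_
        have ha0 : (0 : ℝ) < a ^ k := pow_pos (by linarith [ha.1]) _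
        rw [mul_pow, ← ENNReal.ofReal_pow (by positivity), Real.sq_sqrt (by positivity), mul_pow]

/-- The indicator cuts off a < ρ/R, and the integral of ρ² a⁻³ over (ρ/R, ∞) is exactly R²/2. The
bound is therefore uniform in ρ and A. -/
theorem setLIntegral_indicator_inv_cube_le {A R ρ : ℝ} (hR : 0 < R) (hρ : 0 ≤ ρ) :
    ∫⁻ a in Ioc 1 A, {a : ℝ | ρ ≤ a * R}.indicator (fun a => ENNReal.ofReal (ρ ^ 2 * (a ^ 3)⁻¹)) a ≤
      ENNReal.ofReal (R ^ 2 / 2) := by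
  rcases hρ.eq_or_lt with rfl | hρ
  · simp
  have hc : 0 < ρ / R := div_pos hρ hR
  have hi := integrableOn_Ioi_rpow_of_lt (a := -3) (by norm_num) hc
  have hv := integral_Ioi_rpow_of_lt (a := -3) (by norm_num) hc
  calc _ ≤ ∫⁻ a, (Ici (ρ / R)).indicator (fun a => ENNReal.ofReal (ρ ^ 2 * (a ^ 3)⁻¹)) a := by
        refine (setLIntegral_le_lintegral _ _).trans (lintegral_mono fun a => ?_)
        refine indicator_le_indicator_of_subset ?_ (fun _ => bot_le) a
        intro a ha
        simp only [mem_Ici, mem_ofPred_eq] at *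
        rwa [div_le_iff₀ hR]
    _ = ∫⁻ a in Ioi (ρ / R), ENNReal.ofReal (ρ ^ 2 * a ^ (-3 : ℝ)) := by
        rw [lintegral_indicator measurableSet_Ici, setLIntegral_congr Ioi_ae_eq_Ici.symm]
        refine setLIntegral_congr_fun measurableSet_Ioi fun a ha => ?_
        have ha0 : 0 < a := hc.trans ha
        rw [Real.rpow_neg ha0.le]; norm_num
    _ = ENNReal.ofReal (∫ a in Ioi (ρ / R), ρ ^ 2 * a ^ (-3 : ℝ)) := by
        rw [ofReal_integral_eq_lintegral_ofReal (hi.const_mul _)]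
        filter_upwards [ae_restrict_mem measurableSet_Ioi] with a ha
        have ha0 : 0 < a := hc.trans ha
        positivity
    _ = ENNReal.ofReal (R ^ 2 / 2) := by
        rw [integral_const_mul, hv]
        congr 1
        rw [show (-3 : ℝ) + 1 = -2 by norm_num, Real.rpow_neg hc.le]
        norm_num
        field_simp

variable [MeasurableSpace E] [BorelSpace E] [FiniteDimensional ℝ E]

theorem lintegral_comp_stretch (μ : Measure E) [μ.IsAddHaarMeasure] (P : E →L[ℝ] E) {a δ : ℝ}
    (hδ : 0 < δ) (hdet : LinearMap.det (stretch P a : E →ₗ[ℝ] E) = δ) {F : E → ℝ≥0∞}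
    (hF : Measurable F) :
    ∫⁻ x, F x ∂μ = ENNReal.ofReal δ * ∫⁻ x, F (stretch P a x) ∂μ := by
  have h := μ.map_linearMap_addHaar_eq_smul_addHaar (f := (stretch P a : E →ₗ[ℝ] E))
    (by rw [hdet]; exact hδ.ne')
  have h2 := lintegral_map (μ := μ) hF (stretch P a).continuous.measurable
  rw [ContinuousLinearMap.coe_coe] at h
  rw [← h2, h, lintegral_smul_measure, hdet, smul_eq_mul, ← mul_assoc,
    ← ENNReal.ofReal_mul hδ.le, abs_of_pos (by positivity), mul_inv_cancel₀ hδ.ne']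
  simp

/-- The pointwise bound is integrated over B, the order of integration exchanged, and z = `stretch P
a x` substituted. As P is a projection, P z = a P x, so the weight a^k |P x|² dx becomes |P z|² a⁻³
dz, restricted to |P z| ≤ aR because |P x| ≤ R on B. Its a-integral is at most R²/2, and k survives
only in the factor ∫ a^(-k). -/
theorem setLIntegral_sub_stretch_sq_le (μ : Measure E) [μ.IsAddHaarMeasure] (P : E →L[ℝ] E)
    (hP : ∀ x, P (P x) = P x) (k : ℕ)
    (hdet : ∀ a : ℝ, 1 ≤ a → LinearMap.det (stretch P a : E →ₗ[ℝ] E) = a ^ (k + 1))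
    {u : E → ℝ} (hu : ContDiff ℝ 1 u) {A R : ℝ} (hA : 1 ≤ A) (hR : 0 < R) {B C : Set E}
    (hB : MeasurableSet B) (hC : MeasurableSet C) (hBR : ∀ x ∈ B, ‖P x‖ ≤ R)
    (hBC : ∀ a ∈ Ioc 1 A, ∀ x ∈ B, stretch P a x ∈ C) :
    ∫⁻ x in B, ‖u x - u (stretch P A x)‖ₑ ^ 2 ∂μ ≤
      (∫⁻ a in Ioc 1 A, ENNReal.ofReal (a ^ k)⁻¹) * ENNReal.ofReal (R ^ 2 / 2) *
        ∫⁻ z in C, ‖fderiv ℝ u z‖ₑ ^ 2 ∂μ := by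
  have hfd : Continuous (fderiv ℝ u) := hu.continuous_fderiv (by simp)
  have hjoint : Continuous fun p : E × ℝ => stretch P p.2 p.1 := by
    simp only [stretch_apply]; fun_prop
  have hfdj : Measurable fun p : E × ℝ => ‖fderiv ℝ u (stretch P p.2 p.1)‖ₑ :=
    (hfd.comp hjoint).enorm.measurable
  set F : ℝ → E → ℝ≥0∞ := fun a z => {a : ℝ | ‖P z‖ ≤ a * R}.indicator
    (fun a => ENNReal.ofReal (‖P z‖ ^ 2 * (a ^ 3)⁻¹)) a * C.indicator (fun z => ‖fderiv ℝ u z‖ₑ ^ 2) z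
    with hFdef
  have hFm : Measurable fun p : ℝ × E => F p.1 p.2 := by
    refine Measurable.mul ?_ ?_
    · have hs : MeasurableSet {p : ℝ × E | ‖P p.2‖ ≤ p.1 * R} := by
        apply measurableSet_le <;> fun_prop
      exact Measurable.indicator (f := fun p : ℝ × E => ENNReal.ofReal (‖P p.2‖ ^ 2 * (p.1 ^ 3)⁻¹))
        (by fun_prop) hs
    · exact ((hfd.enorm.measurable.pow_const 2).indicator hC).comp measurable_snd
  calc _ ≤ ∫⁻ x in B, ((∫⁻ a in Ioc 1 A, ENNReal.ofReal (a ^ k)⁻¹) *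
        ∫⁻ a in Ioc 1 A,
          ENNReal.ofReal (a ^ k) * (‖fderiv ℝ u (stretch P a x)‖ₑ ^ 2 * ‖P x‖ₑ ^ 2)) ∂μ :=
        lintegral_mono fun x => enorm_sub_stretch_sq_le P hu k hA x
    _ = (∫⁻ a in Ioc 1 A, ENNReal.ofReal (a ^ k)⁻¹) * ∫⁻ x in B, (∫⁻ a in Ioc 1 A,
          ENNReal.ofReal (a ^ k) * (‖fderiv ℝ u (stretch P a x)‖ₑ ^ 2 * ‖P x‖ₑ ^ 2)) ∂μ := by
        refine lintegral_const_mul _ (Measurable.lintegral_prod_right' (f := fun p : E × ℝ =>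
          ENNReal.ofReal (p.2 ^ k) * (‖fderiv ℝ u (stretch P p.2 p.1)‖ₑ ^ 2 * ‖P p.1‖ₑ ^ 2)) ?_)
        fun_prop
    _ ≤ (∫⁻ a in Ioc 1 A, ENNReal.ofReal (a ^ k)⁻¹) * ∫⁻ a in Ioc 1 A, ∫⁻ x in B,
          ENNReal.ofReal (a ^ k) * (‖fderiv ℝ u (stretch P a x)‖ₑ ^ 2 * ‖P x‖ₑ ^ 2) ∂μ := by
        rw [lintegral_lintegral_swap]
        exact Measurable.aemeasurable (by simp only [Function.uncurry_def]; fun_prop)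
    _ ≤ (∫⁻ a in Ioc 1 A, ENNReal.ofReal (a ^ k)⁻¹) * ∫⁻ a in Ioc 1 A, ∫⁻ z, F a z ∂μ := by
        refine mul_le_mul' le_rfl ?_
        refine setLIntegral_mono' measurableSet_Ioc fun a ha => ?_
        have ha0 : 0 < a := by linarith [ha.1]
        have hFa : Measurable (F a) := hFm.comp (measurable_const.prodMk measurable_id)
        rw [lintegral_comp_stretch μ P (a := a) (pow_pos ha0 (k + 1)) (hdet a ha.1.le) hFa,
          ← lintegral_const_mul _ (show Measurable fun x => F a (stretch P a x) from
            hFa.comp (stretch P a).continuous.measurable)]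
        refine (setLIntegral_mono' hB fun x hx => ?_).trans (setLIntegral_le_lintegral B _)
        have hPx : P (stretch P a x) = a • P x := by
          rw [stretch_apply, map_add, map_smul, hP]; module
        have hmem : a ∈ {a' : ℝ | ‖P (stretch P a x)‖ ≤ a' * R} := by
          rw [mem_ofPred_eq, hPx, norm_smul, Real.norm_of_nonneg ha0.le]
          gcongr
          exact hBR x hx
        simp only [hFdef, indicator_of_mem hmem, indicator_of_mem (hBC a ha x hx)]
        have he : ENNReal.ofReal (a ^ (k + 1)) * ENNReal.ofReal ((a * ‖P x‖) ^ 2 * (a ^ 3)⁻¹) =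
            ENNReal.ofReal (a ^ k) * ‖P x‖ₑ ^ 2 := by
          rw [← ofReal_norm (P x), ← ENNReal.ofReal_pow (norm_nonneg _),
            ← ENNReal.ofReal_mul (by positivity), ← ENNReal.ofReal_mul (by positivity)]
          congr 1
          field_simp
          ring
        rw [hPx, norm_smul, Real.norm_of_nonneg ha0.le,
          ← mul_assoc (ENNReal.ofReal (a ^ (k + 1))), he]
        exact le_of_eq (by ring)
    _ = (∫⁻ a in Ioc 1 A, ENNReal.ofReal (a ^ k)⁻¹) * ∫⁻ z, (∫⁻ a in Ioc 1 A, F a z) ∂μ := by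
        rw [lintegral_lintegral_swap hFm.aemeasurable]
    _ ≤ (∫⁻ a in Ioc 1 A, ENNReal.ofReal (a ^ k)⁻¹) *
          ∫⁻ z, ENNReal.ofReal (R ^ 2 / 2) * C.indicator (fun z => ‖fderiv ℝ u z‖ₑ ^ 2) z ∂μ := by
        gcongr with z
        simp only [hFdef]
        rw [lintegral_mul_const _ (Measurable.indicator (by fun_prop)
          (measurableSet_le (by fun_prop) (by fun_prop)))]
        gcongr
        exact setLIntegral_indicator_inv_cube_le hR (norm_nonneg _)
    _ = _ := by
        rw [lintegral_const_mul _ ((hfd.enorm.measurable.pow_const 2).indicator hC),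
          lintegral_indicator hC, mul_assoc]

end Flow

/-! ### Splitting squares and the one-dimensional weight integrals -/

theorem enorm_sub_sq_le_two_mul {F : Type*} [NormedAddCommGroup F] (a b c : F) :
    ‖a - c‖ₑ ^ 2 ≤ 2 * ‖a - b‖ₑ ^ 2 + 2 * ‖b - c‖ₑ ^ 2 := by
  have h1 : ‖a - c‖ ≤ ‖a - b‖ + ‖b - c‖ := norm_sub_le_norm_sub_add_norm_sub a b c
  have h2 : ‖a - c‖ ^ 2 ≤ 2 * ‖a - b‖ ^ 2 + 2 * ‖b - c‖ ^ 2 := by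
    nlinarith [norm_nonneg (a - c), sq_nonneg (‖a - b‖ - ‖b - c‖)]
  have h3 := ENNReal.ofReal_le_ofReal h2
  rw [ENNReal.ofReal_add (by positivity) (by positivity), ENNReal.ofReal_mul (by norm_num),
    ENNReal.ofReal_mul (by norm_num), ENNReal.ofReal_pow (norm_nonneg _),
    ENNReal.ofReal_pow (norm_nonneg _), ENNReal.ofReal_pow (norm_nonneg _)] at h3
  simpa using h3

theorem setLIntegral_ofReal_pow_two_inv_le (A : ℝ) :
    ∫⁻ a in Ioc 1 A, ENNReal.ofReal (a ^ 2)⁻¹ ≤ 1 := by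
  have hi := integrableOn_Ioi_rpow_of_lt (a := -2) (by norm_num) one_pos
  have hv := integral_Ioi_rpow_of_lt (a := -2) (by norm_num) one_pos
  calc _ ≤ ∫⁻ a in Ioi 1, ENNReal.ofReal (a ^ 2)⁻¹ := lintegral_mono_set Ioc_subset_Ioi_self
    _ = ∫⁻ a in Ioi (1 : ℝ), ENNReal.ofReal (a ^ (-2 : ℝ)) := by
        refine setLIntegral_congr_fun measurableSet_Ioi fun a ha => ?_
        have ha0 : 0 < a := one_pos.trans ha
        rw [Real.rpow_neg ha0.le]; norm_num
    _ = ENNReal.ofReal (∫ a in Ioi (1 : ℝ), a ^ (-2 : ℝ)) := by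
        rw [ofReal_integral_eq_lintegral_ofReal hi]
        filter_upwards [ae_restrict_mem measurableSet_Ioi] with a ha
        have ha0 : 0 < a := one_pos.trans ha
        positivity
    _ ≤ 1 := by rw [hv]; norm_num

theorem setLIntegral_ofReal_inv {A : ℝ} (hA : 1 ≤ A) :
    ∫⁻ a in Ioc 1 A, ENNReal.ofReal (a ^ 1)⁻¹ = ENNReal.ofReal (Real.log A) := by
  have h0 : (0 : ℝ) ∉ uIcc 1 A := by rw [uIcc_of_le hA]; intro h; linarith [h.1]
  rw [← integral_inv_of_pos one_pos (by linarith) |>.trans (by simp : _ = Real.log A),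
    intervalIntegral.integral_of_le hA, ofReal_integral_eq_lintegral_ofReal]
  · simp
  · have := (intervalIntegral.intervalIntegrable_inv (μ := volume) (f := fun a : ℝ => a)
      (fun x hx => by rintro rfl; exact h0 hx) continuous_id.continuousOn)
    exact (intervalIntegrable_iff_integrableOn_Ioc_of_le hA).1 this
  · filter_upwards [ae_restrict_mem measurableSet_Ioc] with a ha
    have ha0 : 0 < a := one_pos.trans ha.1
    positivity

theorem lintegral_lintegral_two_mul_add {α β : Type*} [MeasurableSpace α] [MeasurableSpace β]
    (μ : Measure α) (ν : Measure β) [SFinite ν] {f g : α → β → ℝ≥0∞}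
    (hf : Measurable (Function.uncurry f)) (hg : Measurable (Function.uncurry g)) :
    ∫⁻ x, ∫⁻ y, (2 * f x y + 2 * g x y) ∂ν ∂μ =
      2 * (∫⁻ x, ∫⁻ y, f x y ∂ν ∂μ) + 2 * ∫⁻ x, ∫⁻ y, g x y ∂ν ∂μ := by
  have h (x : α) : ∫⁻ y, (2 * f x y + 2 * g x y) ∂ν = 2 * ∫⁻ y, f x y ∂ν + 2 * ∫⁻ y, g x y ∂ν := by
    have h1 : Measurable (f x) := hf.of_uncurry_left
    have h2 : Measurable (g x) := hg.of_uncurry_left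
    rw [lintegral_add_left (h1.const_mul 2), lintegral_const_mul _ h1, lintegral_const_mul _ h2]
  have h1 : Measurable fun x => ∫⁻ y, f x y ∂ν := hf.lintegral_prod_right'
  have h2 : Measurable fun x => ∫⁻ y, g x y ∂ν := hg.lintegral_prod_right'
  simp only [h]
  rw [lintegral_add_left (h1.const_mul 2), lintegral_const_mul _ h1, lintegral_const_mul _ h2]

/-! ### Changes of variables, double integrals and Poincaré on convex sets -/

section Flow

variable {E : Type*} [NormedAddCommGroup E] [NormedSpace ℝ E]

theorem stretch_id_apply (a : ℝ) (x : E) : stretch (ContinuousLinearMap.id ℝ E) a x = a • x := by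
  rw [stretch_apply, ContinuousLinearMap.id_apply]; module

theorem det_stretch_id (a : ℝ) :
    LinearMap.det (stretch (ContinuousLinearMap.id ℝ E) a : E →ₗ[ℝ] E) =
      a ^ Module.finrank ℝ E := by
  have : (stretch (ContinuousLinearMap.id ℝ E) a : E →ₗ[ℝ] E) = a • LinearMap.id := by
    ext x
    simp only [ContinuousLinearMap.coe_coe, stretch_apply, ContinuousLinearMap.id_apply,
      LinearMap.smul_apply, LinearMap.id_apply]
    module
  rw [this, LinearMap.det_smul]; simp

variable [MeasurableSpace E] [BorelSpace E]

theorem measurableSet_of_mem_stretch_iff {P : E →L[ℝ] E} {A : ℝ} {B B' : Set E}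
    (hB' : MeasurableSet B') (h : ∀ x, stretch P A x ∈ B' ↔ x ∈ B) : MeasurableSet B := by
  have : B = stretch P A ⁻¹' B' := by ext x; exact (h x).symm
  rw [this]
  exact (stretch P A).continuous.measurable hB'

variable [FiniteDimensional ℝ E]

theorem setLIntegral_stretch (μ : Measure E) [μ.IsAddHaarMeasure] {P : E →L[ℝ] E} {A δ : ℝ}
    (hδ : 0 < δ) (hdet : LinearMap.det (stretch P A : E →ₗ[ℝ] E) = δ) {B B' : Set E}
    (hB' : MeasurableSet B') (h : ∀ x, stretch P A x ∈ B' ↔ x ∈ B) {F : E → ℝ≥0∞}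
    (hF : Measurable F) :
    ∫⁻ x in B', F x ∂μ = ENNReal.ofReal δ * ∫⁻ x in B, F (stretch P A x) ∂μ := by
  rw [← lintegral_indicator hB', lintegral_comp_stretch μ P hδ hdet (hF.indicator hB'),
    ← lintegral_indicator (measurableSet_of_mem_stretch_iff hB' h)]
  congr 1
  refine lintegral_congr fun x => ?_
  by_cases hx : x ∈ B
  · rw [indicator_of_mem hx, indicator_of_mem ((h x).2 hx)]
  · rw [indicator_of_notMem hx, indicator_of_notMem (fun hh => hx ((h x).1 hh))]

theorem measure_stretch (μ : Measure E) [μ.IsAddHaarMeasure] {P : E →L[ℝ] E} {A δ : ℝ}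
    (hδ : 0 < δ) (hdet : LinearMap.det (stretch P A : E →ₗ[ℝ] E) = δ) {B B' : Set E}
    (hB' : MeasurableSet B') (h : ∀ x, stretch P A x ∈ B' ↔ x ∈ B) :
    μ B' = ENNReal.ofReal δ * μ B := by
  simpa using setLIntegral_stretch μ hδ hdet hB' h (F := fun _ => 1) measurable_const

/-- A point of B' is `stretch P A z` with z in B, and u x - u(`stretch P A z`) is split at u z. Both
hypotheses are normalised by μ B, so the Jacobian turns them into a bound normalised by μ B'. The
second increment does not depend on x, which is why μ Q appears in `hφ`. -/
theorem lintegral_lintegral_sub_sq_stretch_le (μ : Measure E) [μ.IsAddHaarMeasure] {P : E →L[ℝ] E}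
    {A δ : ℝ} (hδ : 0 < δ) (hdet : LinearMap.det (stretch P A : E →ₗ[ℝ] E) = δ) {Q B B' : Set E}
    (hB' : MeasurableSet B') (h : ∀ x, stretch P A x ∈ B' ↔ x ∈ B)
    {u : E → ℝ} (hu : Continuous u) {κ φ : ℝ≥0∞}
    (hκ : ∫⁻ x in Q, ∫⁻ z in B, ‖u x - u z‖ₑ ^ 2 ∂μ ∂μ ≤ κ * μ B)
    (hφ : (∫⁻ z in B, ‖u z - u (stretch P A z)‖ₑ ^ 2 ∂μ) * μ Q ≤ φ * μ B) :
    ∫⁻ x in Q, ∫⁻ z in B', ‖u x - u z‖ₑ ^ 2 ∂μ ∂μ ≤ (2 * κ + 2 * φ) * μ B' := by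
  have hB := measurableSet_of_mem_stretch_iff hB' h
  have hm : Measurable fun x => ∫⁻ z in B, ‖u x - u z‖ₑ ^ 2 ∂μ :=
    Measurable.lintegral_prod_right' (f := fun p : E × E => ‖u p.1 - u p.2‖ₑ ^ 2)
      (by fun_prop)
  calc _ = ∫⁻ x in Q, ENNReal.ofReal δ * ∫⁻ z in B, ‖u x - u (stretch P A z)‖ₑ ^ 2 ∂μ ∂μ := by
        refine lintegral_congr fun x => ?_
        exact setLIntegral_stretch μ hδ hdet hB' h (by fun_prop)
    _ ≤ ∫⁻ x in Q, ENNReal.ofReal δ * (2 * (∫⁻ z in B, ‖u x - u z‖ₑ ^ 2 ∂μ) +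
          2 * ∫⁻ z in B, ‖u z - u (stretch P A z)‖ₑ ^ 2 ∂μ) ∂μ := by
        gcongr with x
        rw [← lintegral_const_mul _ (by fun_prop), ← lintegral_const_mul _ (by fun_prop),
          ← lintegral_add_left (by fun_prop)]
        exact lintegral_mono fun z => enorm_sub_sq_le_two_mul _ _ _
    _ = ENNReal.ofReal δ * (2 * (∫⁻ x in Q, ∫⁻ z in B, ‖u x - u z‖ₑ ^ 2 ∂μ ∂μ) +
          2 * ((∫⁻ z in B, ‖u z - u (stretch P A z)‖ₑ ^ 2 ∂μ) * μ Q)) := by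
        rw [lintegral_const_mul _ (by fun_prop), lintegral_add_left (by fun_prop),
          lintegral_const_mul _ hm, setLIntegral_const]
        ring
    _ ≤ ENNReal.ofReal δ * (2 * (κ * μ B) + 2 * (φ * μ B)) := by gcongr
    _ = _ := by rw [measure_stretch μ hδ hdet hB' h]; ring

/-- The difference u x - u y is split at the midpoint. With y as origin, x is the image of the
midpoint under the dilation by 2, so the stretch estimate applies; stopping at the midpoint keeps
the factor a in [1,2] and the Jacobian bounded. Convexity keeps the segments inside Q. -/
theorem lintegral_lintegral_sub_sq_le_of_convex (hE : Module.finrank ℝ E = 3) (μ : Measure E)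
    [μ.IsAddHaarMeasure] {Q : Set E} (hQ : Convex ℝ Q) (hQm : MeasurableSet Q) {D : ℝ}
    (hD : 0 < D) (hQD : ∀ x ∈ Q, ∀ y ∈ Q, ‖x - y‖ ≤ D) {u : E → ℝ} (hu : ContDiff ℝ 1 u) :
    ∫⁻ x in Q, ∫⁻ y in Q, ‖u x - u y‖ₑ ^ 2 ∂μ ∂μ ≤
      ENNReal.ofReal (4 * D ^ 2) * μ Q * ∫⁻ z in Q, ‖fderiv ℝ u z‖ₑ ^ 2 ∂μ := by
  have huc := hu.continuous
  have key : ∀ y ∈ Q, ∫⁻ x in Q, ‖u x - u (midpoint ℝ x y)‖ₑ ^ 2 ∂μ ≤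
      ENNReal.ofReal (D ^ 2) * ∫⁻ z in Q, ‖fderiv ℝ u z‖ₑ ^ 2 ∂μ := by
    intro y hy
    have hmp : Continuous fun x : E => midpoint ℝ x y := by
      simp only [midpoint_eq_smul_add]; fun_prop
    have hF : Measurable fun x => ‖u (y + x) - u (midpoint ℝ (y + x) y)‖ₑ ^ 2 := by fun_prop
    have hshift : ∀ G : E → ℝ≥0∞, ∫⁻ x in Q, G x ∂μ = ∫⁻ x in {x | y + x ∈ Q}, G (y + x) ∂μ := by
      intro G
      have hmeas : MeasurableSet {x | y + x ∈ Q} := (measurable_const_add y) hQm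
      rw [← lintegral_indicator hQm, ← lintegral_indicator hmeas,
        ← lintegral_add_left_eq_self _ y]
      rfl
    have hC : MeasurableSet {x | y + x ∈ Q} := (measurable_const_add y) hQm
    have hB : MeasurableSet {z | y + (2 : ℝ) • z ∈ Q} :=
      (show Measurable fun z : E => y + (2 : ℝ) • z by fun_prop) hQm
    -- Here z is half of x - y, hence the radius D/2. The Jacobian 8 of the dilation then gives 8 ·
    -- (D/2)²/2 = D².
    have hfl := setLIntegral_sub_stretch_sq_le μ (ContinuousLinearMap.id ℝ E) (fun _ => rfl) 2
      (fun a _ => by rw [det_stretch_id, hE])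
      (u := fun z => u (y + z)) (hu.comp (by fun_prop)) (A := 2) (R := D / 2) (by norm_num)
      (by positivity) hB hC
      (fun z hz => by
        have := hQD _ hz y hy
        rw [add_sub_cancel_left, norm_smul, Real.norm_of_nonneg zero_le_two] at this
        simp only [ContinuousLinearMap.id_apply]
        linarith)
      (fun a ha z hz => by
        have h2 := hQ hy hz (a := 1 - a / 2) (b := a / 2) (by linarith [ha.2]) (by linarith [ha.1])
          (by ring)
        rw [stretch_id_apply]
        show y + a • z ∈ Q
        convert h2 using 1
        module)
    have hfder : ∀ z, fderiv ℝ (fun z => u (y + z)) z = fderiv ℝ u (y + z) := fun z =>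
      fderiv_comp_add_left y
    simp only [hfder] at hfl
    rw [← hshift (fun z => ‖fderiv ℝ u z‖ₑ ^ 2)] at hfl
    rw [hshift, setLIntegral_stretch μ (P := ContinuousLinearMap.id ℝ E) (A := 2) (δ := 8)
      (B := {z | y + (2 : ℝ) • z ∈ Q}) (by norm_num) (by rw [det_stretch_id, hE]; norm_num) hC
      (fun x => by rw [stretch_id_apply]; rfl) hF]
    calc _ = ENNReal.ofReal 8 * ∫⁻ z in {z | y + (2 : ℝ) • z ∈ Q},
          ‖u (y + z) - u (y + stretch (ContinuousLinearMap.id ℝ E) 2 z)‖ₑ ^ 2 ∂μ := by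
          congr 1
          refine lintegral_congr fun z => ?_
          rw [stretch_id_apply, show midpoint ℝ (y + (2 : ℝ) • z) y = y + z by
            rw [midpoint_eq_smul_add, invOf_eq_inv]; module, ← enorm_neg, neg_sub]
      _ ≤ ENNReal.ofReal 8 * (1 * ENNReal.ofReal ((D / 2) ^ 2 / 2) *
          ∫⁻ z in Q, ‖fderiv ℝ u z‖ₑ ^ 2 ∂μ) := by
          gcongr
          refine hfl.trans ?_
          gcongr
          exact setLIntegral_ofReal_pow_two_inv_le 2
      _ = _ := by
          rw [one_mul, ← mul_assoc, ← ENNReal.ofReal_mul (by norm_num)]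
          congr 2; ring
  have hmid : Continuous fun p : E × E => midpoint ℝ p.1 p.2 := by
    simp only [midpoint_eq_smul_add]; fun_prop
  have hm2 : Measurable fun p : E × E => ‖u p.1 - u (midpoint ℝ p.1 p.2)‖ₑ ^ 2 := by
    have := (huc.comp hmid).measurable
    have h2 := (huc.comp continuous_fst).measurable (α := E × E)
    exact ((h2.sub this).enorm).pow_const 2
  have hm3 : Measurable fun p : E × E => ‖u (midpoint ℝ p.1 p.2) - u p.2‖ₑ ^ 2 := by
    have := (huc.comp hmid).measurable
    have h2 := (huc.comp continuous_snd).measurable (α := E × E)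
    exact ((this.sub h2).enorm).pow_const 2
  calc _ ≤ ∫⁻ x in Q, ∫⁻ y in Q, (2 * ‖u x - u (midpoint ℝ x y)‖ₑ ^ 2 +
        2 * ‖u (midpoint ℝ x y) - u y‖ₑ ^ 2) ∂μ ∂μ := by
        gcongr with x y
        exact enorm_sub_sq_le_two_mul _ _ _
    _ = 2 * (∫⁻ x in Q, ∫⁻ y in Q, ‖u x - u (midpoint ℝ x y)‖ₑ ^ 2 ∂μ ∂μ) +
        2 * ∫⁻ x in Q, ∫⁻ y in Q, ‖u (midpoint ℝ x y) - u y‖ₑ ^ 2 ∂μ ∂μ := by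
        exact lintegral_lintegral_two_mul_add _ _ hm2 hm3
    _ ≤ 2 * (∫⁻ y in Q, (ENNReal.ofReal (D ^ 2) * ∫⁻ z in Q, ‖fderiv ℝ u z‖ₑ ^ 2 ∂μ) ∂μ) +
        2 * ∫⁻ x in Q, (ENNReal.ofReal (D ^ 2) * ∫⁻ z in Q, ‖fderiv ℝ u z‖ₑ ^ 2 ∂μ) ∂μ := by
        gcongr ?_ + ?_
        · gcongr 2 * ?_
          rw [lintegral_lintegral_swap hm2.aemeasurable]
          exact setLIntegral_mono' hQm key
        · gcongr 2 * ?_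
          refine setLIntegral_mono' hQm fun x hx => ?_
          refine le_of_eq_of_le (lintegral_congr fun y => ?_) (key x hx)
          rw [midpoint_comm, ← enorm_neg, neg_sub]
    _ = _ := by
        rw [setLIntegral_const, ENNReal.ofReal_mul (by norm_num)]
        norm_num
        ring

end Flow

/-! ### Diagonal maps and the geometry of cylinders -/

/-- The diagonal linear map with entries `d` on Euclidean space. -/
noncomputable def diagonalCLM {N : ℕ} (d : Fin N → ℝ) :
    EuclideanSpace ℝ (Fin N) →L[ℝ] EuclideanSpace ℝ (Fin N) :=
  Matrix.toEuclideanCLM (𝕜 := ℝ) (Matrix.diagonal d)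

theorem diagonalCLM_apply {N : ℕ} (d : Fin N → ℝ) (x : EuclideanSpace ℝ (Fin N)) (i : Fin N) :
    diagonalCLM d x i = d i * x i := by
  simp [diagonalCLM, Matrix.mulVec_diagonal, Matrix.ofLp_toEuclideanCLM]

theorem stretch_diagonalCLM {N : ℕ} (d : Fin N → ℝ) (a : ℝ) :
    stretch (diagonalCLM d) a = diagonalCLM (fun i => 1 + (a - 1) * d i) := by
  ext x i
  rw [stretch_apply, diagonalCLM_apply]
  simp only [PiLp.add_apply, PiLp.smul_apply, diagonalCLM_apply, smul_eq_mul]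
  ring

theorem det_diagonalCLM {N : ℕ} (d : Fin N → ℝ) :
    LinearMap.det (diagonalCLM d : EuclideanSpace ℝ (Fin N) →ₗ[ℝ] EuclideanSpace ℝ (Fin N)) =
      ∏ i, d i := by
  have : (diagonalCLM d : EuclideanSpace ℝ (Fin N) →ₗ[ℝ] EuclideanSpace ℝ (Fin N)) =
      Matrix.toLin (PiLp.basisFun 2 ℝ (Fin N)) (PiLp.basisFun 2 ℝ (Fin N))
        (Matrix.diagonal d) := by
    rw [← Matrix.toLpLin_eq_toLin]
    ext x i
    simp [diagonalCLM_apply, Matrix.mulVec_diagonal]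
  rw [this, LinearMap.det_toLin, Matrix.det_diagonal]

theorem isOpen_solidCylinder (l h : ℝ) : IsOpen (solidCylinder l h) := by
  have h1 : IsOpen {x : EuclideanSpace ℝ (Fin 3) | x 0 ^ 2 + x 1 ^ 2 < l ^ 2} :=
    isOpen_lt (by fun_prop) (by fun_prop)
  have h2 : IsOpen {x : EuclideanSpace ℝ (Fin 3) | -h < x 2} := isOpen_lt (by fun_prop) (by fun_prop)
  have h3 : IsOpen {x : EuclideanSpace ℝ (Fin 3) | x 2 < h} := isOpen_lt (by fun_prop) (by fun_prop)
  exact h1.inter (h2.inter h3)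

theorem convex_solidCylinder (l h : ℝ) : Convex ℝ (solidCylinder l h) := by
  rintro x ⟨hx1, hx2, hx3⟩ y ⟨hy1, hy2, hy3⟩ a b ha hb hab
  obtain rfl : b = 1 - a := by linarith
  refine ⟨?_, ?_, ?_⟩ <;> simp only [PiLp.add_apply, PiLp.smul_apply, smul_eq_mul]
  · have h1 : (a * x 0 + (1 - a) * y 0) ^ 2 + (a * x 1 + (1 - a) * y 1) ^ 2 ≤
        a * (x 0 ^ 2 + x 1 ^ 2) + (1 - a) * (y 0 ^ 2 + y 1 ^ 2) := by
      nlinarith [mul_nonneg (mul_nonneg ha hb) (sq_nonneg (x 0 - y 0)),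
        mul_nonneg (mul_nonneg ha hb) (sq_nonneg (x 1 - y 1))]
    rcases ha.eq_or_lt with rfl | ha
    · linarith
    · nlinarith [mul_lt_mul_of_pos_left hx1 ha, mul_le_mul_of_nonneg_left hy1.le hb]
  · rcases ha.eq_or_lt with rfl | ha
    · linarith
    · nlinarith [mul_lt_mul_of_pos_left hx2 ha, mul_le_mul_of_nonneg_left hy2.le hb]
  · rcases ha.eq_or_lt with rfl | ha
    · linarith
    · nlinarith [mul_lt_mul_of_pos_left hx3 ha, mul_le_mul_of_nonneg_left hy3.le hb]

theorem solidCylinder_mono {l l' h h' : ℝ} (hl : 0 ≤ l) (hll : l ≤ l') (hh : h ≤ h') :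
    solidCylinder l h ⊆ solidCylinder l' h' := by
  rintro x ⟨h1, h2, h3⟩
  refine ⟨h1.trans_le (by gcongr), by linarith, by linarith⟩

theorem norm_sq_eq_fin_three (x : EuclideanSpace ℝ (Fin 3)) :
    ‖x‖ ^ 2 = x 0 ^ 2 + x 1 ^ 2 + x 2 ^ 2 := by
  rw [EuclideanSpace.real_norm_sq_eq, Fin.sum_univ_three]

theorem norm_sq_le_of_mem_solidCylinder {l h : ℝ} {x : EuclideanSpace ℝ (Fin 3)}
    (hx : x ∈ solidCylinder l h) : ‖x‖ ^ 2 ≤ l ^ 2 + h ^ 2 := by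
  obtain ⟨h1, h2, h3⟩ := hx
  rw [norm_sq_eq_fin_three]
  nlinarith

theorem ball_subset_solidCylinder {S l h : ℝ} (hS : 0 ≤ S) (hl : S ≤ l) (hh : S ≤ h) :
    Metric.ball 0 S ⊆ solidCylinder l h := by
  intro x hx
  rw [mem_ball_zero_iff] at hx
  have h1 : ‖x‖ ^ 2 < S ^ 2 := by gcongr
  rw [norm_sq_eq_fin_three] at h1
  have h2 : |x 2| < S := abs_lt_of_sq_lt_sq (by nlinarith [sq_nonneg (x 0), sq_nonneg (x 1)]) hS
  rw [abs_lt] at h2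
  refine ⟨?_, by linarith, by linarith⟩
  nlinarith [sq_nonneg (x 2)]

theorem isBounded_solidCylinder (l h : ℝ) : Bornology.IsBounded (solidCylinder l h) := by
  refine (Metric.isBounded_closedBall (x := (0 : EuclideanSpace ℝ (Fin 3)))
    (r := Real.sqrt (l ^ 2 + h ^ 2))).subset ?_
  intro x hx
  rw [mem_closedBall_zero_iff]
  exact Real.le_sqrt_of_sq_le (norm_sq_le_of_mem_solidCylinder hx)

theorem volume_solidCylinder_lt_top (l h : ℝ) : volume (solidCylinder l h) < ⊤ :=
  (isBounded_solidCylinder l h).measure_lt_top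

theorem volume_solidCylinder_pos {l h : ℝ} (hl : 0 < l) (hh : 0 < h) :
    0 < volume (solidCylinder l h) :=
  (isOpen_solidCylinder l h).measure_pos _ ⟨0, ball_subset_solidCylinder (S := min l h)
    (by positivity) (min_le_left _ _) (min_le_right _ _) (by simp [hl, hh])⟩

/-- The projection onto the first two coordinates. -/
noncomputable def horizontalProj : EuclideanSpace ℝ (Fin 3) →L[ℝ] EuclideanSpace ℝ (Fin 3) :=
  diagonalCLM ![1, 1, 0]

/-- The projection onto the third coordinate. -/
noncomputable def verticalProj : EuclideanSpace ℝ (Fin 3) →L[ℝ] EuclideanSpace ℝ (Fin 3) :=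
  diagonalCLM ![0, 0, 1]

theorem det_stretch_horizontalProj (a : ℝ) :
    LinearMap.det (stretch horizontalProj a : EuclideanSpace ℝ (Fin 3) →ₗ[ℝ] _) = a ^ 2 := by
  rw [horizontalProj, stretch_diagonalCLM, det_diagonalCLM, Fin.prod_univ_three]
  simp; ring

theorem det_stretch_verticalProj (a : ℝ) :
    LinearMap.det (stretch verticalProj a : EuclideanSpace ℝ (Fin 3) →ₗ[ℝ] _) = a := by
  rw [verticalProj, stretch_diagonalCLM, det_diagonalCLM, Fin.prod_univ_three]
  simp

theorem stretch_horizontalProj_mem_iff {a l h : ℝ} (ha : 0 < a) (x : EuclideanSpace ℝ (Fin 3)) :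
    stretch horizontalProj a x ∈ solidCylinder (a * l) h ↔ x ∈ solidCylinder l h := by
  have h2 : (a * x 0) ^ 2 + (a * x 1) ^ 2 < (a * l) ^ 2 ↔ x 0 ^ 2 + x 1 ^ 2 < l ^ 2 := by
    rw [show (a * x 0) ^ 2 + (a * x 1) ^ 2 = a ^ 2 * (x 0 ^ 2 + x 1 ^ 2) by ring, mul_pow,
      mul_lt_mul_iff_right₀ (pow_pos ha 2)]
  simpa [horizontalProj, stretch_diagonalCLM, solidCylinder, diagonalCLM_apply] using fun _ _ => h2

theorem stretch_verticalProj_mem_iff {a l h : ℝ} (ha : 0 < a) (x : EuclideanSpace ℝ (Fin 3)) :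
    stretch verticalProj a x ∈ solidCylinder l (a * h) ↔ x ∈ solidCylinder l h := by
  have h1 : -(a * h) < a * x 2 ↔ -h < x 2 := by
    rw [← mul_neg, mul_lt_mul_iff_right₀ ha]
  have h2 : a * x 2 < a * h ↔ x 2 < h := mul_lt_mul_iff_right₀ ha
  simp [verticalProj, stretch_diagonalCLM, solidCylinder, diagonalCLM_apply, h1, h2]

theorem smul_mem_solidCylinder_iff {a l h : ℝ} (ha : 0 < a) (x : EuclideanSpace ℝ (Fin 3)) :
    a • x ∈ solidCylinder (a * l) (a * h) ↔ x ∈ solidCylinder l h := by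
  have h1 : -(a * h) < a * x 2 ↔ -h < x 2 := by
    rw [← mul_neg, mul_lt_mul_iff_right₀ ha]
  have h2 : a * x 2 < a * h ↔ x 2 < h := mul_lt_mul_iff_right₀ ha
  have h3 : (a * x 0) ^ 2 + (a * x 1) ^ 2 < (a * l) ^ 2 ↔ x 0 ^ 2 + x 1 ^ 2 < l ^ 2 := by
    rw [show (a * x 0) ^ 2 + (a * x 1) ^ 2 = a ^ 2 * (x 0 ^ 2 + x 1 ^ 2) by ring, mul_pow,
      mul_lt_mul_iff_right₀ (pow_pos ha 2)]
  simp [solidCylinder, h1, h2, h3]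

theorem volume_solidCylinder_mul {a : ℝ} (ha : 0 < a) (l h : ℝ) :
    volume (solidCylinder (a * l) (a * h)) = ENNReal.ofReal (a ^ 3) * volume (solidCylinder l h) :=
  measure_stretch volume (P := ContinuousLinearMap.id ℝ _) (A := a) (pow_pos ha 3)
    (by rw [det_stretch_id]; simp) (isOpen_solidCylinder _ _).measurableSet
    (fun x => by rw [stretch_id_apply]; exact smul_mem_solidCylinder_iff ha x)

/-! ### Poincaré estimates on cylinders for smooth functions -/

theorem setLIntegral_cube_sub_sq_le {S : ℝ} (hS : 0 < S) {u : EuclideanSpace ℝ (Fin 3) → ℝ}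
    (hu : ContDiff ℝ 1 u) :
    ∫⁻ x in solidCylinder S S, ∫⁻ y in solidCylinder S S, ‖u x - u y‖ₑ ^ 2 ≤
      ENNReal.ofReal (32 * S ^ 2) * volume (solidCylinder S S) *
        ∫⁻ z in solidCylinder S S, ‖fderiv ℝ u z‖ₑ ^ 2 := by
  -- Points of C(S,S) have squared norm at most 2S², so the diameter is at most √8 S and 4D² = 32S².
  have h := lintegral_lintegral_sub_sq_le_of_convex (by simp) volume (convex_solidCylinder S S)
    (isOpen_solidCylinder S S).measurableSet (D := Real.sqrt 8 * S) (by positivity) (by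
      intro x hx y hy
      have h1 := norm_sq_le_of_mem_solidCylinder hx
      have h2 := norm_sq_le_of_mem_solidCylinder hy
      refine abs_le_of_sq_le_sq' ?_ (by positivity) |>.2
      rw [mul_pow, Real.sq_sqrt (by norm_num)]
      have h3 := norm_sub_le x y
      nlinarith [norm_nonneg (x - y), sq_nonneg (‖x‖ - ‖y‖)]) hu
  rw [mul_pow, Real.sq_sqrt (by norm_num)] at h
  convert h using 4
  ring

theorem setLIntegral_sub_smul_sq_le {S A : ℝ} (hS : 0 < S) (hA : 1 ≤ A)
    {u : EuclideanSpace ℝ (Fin 3) → ℝ} (hu : ContDiff ℝ 1 u) :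
    ∫⁻ z in solidCylinder S S, ‖u z - u (stretch (ContinuousLinearMap.id ℝ _) A z)‖ₑ ^ 2 ≤
      ENNReal.ofReal (S ^ 2) * ∫⁻ z in solidCylinder (A * S) (A * S), ‖fderiv ℝ u z‖ₑ ^ 2 := by
  refine (setLIntegral_sub_stretch_sq_le volume (ContinuousLinearMap.id ℝ _) (fun _ => rfl) 2
    (fun a _ => by rw [det_stretch_id]; simp) hu hA (R := Real.sqrt 2 * S) (by positivity)
    (isOpen_solidCylinder S S).measurableSet (isOpen_solidCylinder (A * S) (A * S)).measurableSet
    (fun x hx => ?_) (fun a ha x hx => ?_)).trans ?_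
  · refine abs_le_of_sq_le_sq' ?_ (by positivity) |>.2
    rw [mul_pow, Real.sq_sqrt (by norm_num)]
    exact (norm_sq_le_of_mem_solidCylinder hx).trans (by linarith)
  · have ha0 : 0 < a := one_pos.trans ha.1
    rw [stretch_id_apply]
    refine solidCylinder_mono (by positivity) ?_ ?_ ((smul_mem_solidCylinder_iff ha0 x).2 hx)
    all_goals exact mul_le_mul_of_nonneg_right ha.2 hS.le
  · gcongr
    calc _ ≤ 1 * ENNReal.ofReal ((Real.sqrt 2 * S) ^ 2 / 2) := by
          gcongr; exact setLIntegral_ofReal_pow_two_inv_le A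
      _ = _ := by rw [mul_pow, Real.sq_sqrt (by norm_num), one_mul]; congr 1; ring

theorem setLIntegral_sub_horizontal_sq_le {l h A : ℝ} (hl : 0 < l) (hA : 1 ≤ A)
    {u : EuclideanSpace ℝ (Fin 3) → ℝ} (hu : ContDiff ℝ 1 u) :
    ∫⁻ z in solidCylinder l h, ‖u z - u (stretch horizontalProj A z)‖ₑ ^ 2 ≤
      ENNReal.ofReal (Real.log A * (l ^ 2 / 2)) *
        ∫⁻ z in solidCylinder (A * l) h, ‖fderiv ℝ u z‖ₑ ^ 2 := by
  refine (setLIntegral_sub_stretch_sq_le volume horizontalProj (fun x => ?_) 1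
    (fun a _ => det_stretch_horizontalProj a) hu hA hl
    (isOpen_solidCylinder l h).measurableSet (isOpen_solidCylinder (A * l) h).measurableSet
    (fun x hx => ?_) (fun a ha x hx => ?_)).trans ?_
  · ext i
    fin_cases i <;> simp [horizontalProj, diagonalCLM_apply]
  · refine abs_le_of_sq_le_sq' ?_ hl.le |>.2
    rw [norm_sq_eq_fin_three]
    simpa [horizontalProj, diagonalCLM_apply] using hx.1.le
  · have ha0 : 0 < a := one_pos.trans ha.1
    refine solidCylinder_mono (by positivity) ?_ le_rfl ((stretch_horizontalProj_mem_iff ha0 x).2 hx)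
    exact mul_le_mul_of_nonneg_right ha.2 hl.le
  · gcongr
    rw [setLIntegral_ofReal_inv hA, ← ENNReal.ofReal_mul (Real.log_nonneg hA)]

theorem setLIntegral_sub_vertical_sq_le {l h A : ℝ} (hh : 0 < h) (hl : 0 ≤ l) (hA : 1 ≤ A)
    {u : EuclideanSpace ℝ (Fin 3) → ℝ} (hu : ContDiff ℝ 1 u) :
    ∫⁻ z in solidCylinder l h, ‖u z - u (stretch verticalProj A z)‖ₑ ^ 2 ≤
      ENNReal.ofReal (A * (h ^ 2 / 2)) *
        ∫⁻ z in solidCylinder l (A * h), ‖fderiv ℝ u z‖ₑ ^ 2 := by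
  refine (setLIntegral_sub_stretch_sq_le volume verticalProj (fun x => ?_) 0
    (fun a _ => by rw [det_stretch_verticalProj]; simp) hu hA hh
    (isOpen_solidCylinder l h).measurableSet (isOpen_solidCylinder l (A * h)).measurableSet
    (fun x hx => ?_) (fun a ha x hx => ?_)).trans ?_
  · ext i
    fin_cases i <;> simp [verticalProj, diagonalCLM_apply]
  · refine abs_le_of_sq_le_sq' ?_ hh.le |>.2
    rw [norm_sq_eq_fin_three]
    simp only [verticalProj, diagonalCLM_apply]
    simp only [Matrix.cons_val, zero_mul, one_mul]
    nlinarith [hx.2.1, hx.2.2]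
  · have ha0 : 0 < a := one_pos.trans ha.1
    refine solidCylinder_mono hl le_rfl ?_ ((stretch_verticalProj_mem_iff ha0 x).2 hx)
    exact mul_le_mul_of_nonneg_right ha.2 hh.le
  · gcongr
    rw [ENNReal.ofReal_mul (by linarith)]
    gcongr
    simp only [pow_zero, inv_one, ENNReal.ofReal_one, setLIntegral_const, one_mul, Real.volume_Ioc]
    gcongr
    linarith

/-- C(S,S) is dilated to C(m,m) with m = min(l,h), then stretched in the longer direction only. Each
stage turns a constant κ into 2κ + 2S²: 32 becomes 66, then 134. -/
theorem setLIntegral_solidCylinder_sub_sq_le {S l h : ℝ} (hS : 0 < S) (hSl : S ≤ l) (hSh : S ≤ h)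
    (hlog : S * Real.log (l / h) ≤ 2 * h) (hlin : S * h ≤ 2 * l ^ 2)
    {u : EuclideanSpace ℝ (Fin 3) → ℝ} (hu : ContDiff ℝ 1 u) :
    ∫⁻ x in solidCylinder S S, ∫⁻ z in solidCylinder l h, ‖u x - u z‖ₑ ^ 2 ≤
      ENNReal.ofReal (134 * S ^ 2) * (∫⁻ z in solidCylinder l h, ‖fderiv ℝ u z‖ₑ ^ 2) *
        volume (solidCylinder l h) := by
  have hl : 0 < l := hS.trans_le hSl
  have hh : 0 < h := hS.trans_le hSh
  set E := ∫⁻ z in solidCylinder l h, ‖fderiv ℝ u z‖ₑ ^ 2 with hEdef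
  have hEmono : ∀ p q, 0 ≤ p → p ≤ l → q ≤ h →
      ∫⁻ z in solidCylinder p q, ‖fderiv ℝ u z‖ₑ ^ 2 ≤ E := fun p q hp hpl hqh =>
    lintegral_mono_set (solidCylinder_mono hp hpl hqh)
  have hvol : ∀ m, 0 < m → volume (solidCylinder S S) =
      ENNReal.ofReal ((S / m) ^ 3) * volume (solidCylinder m m) := fun m hm => by
    have := volume_solidCylinder_mul (a := S / m) (by positivity) m m
    rwa [div_mul_cancel₀ _ hm.ne'] at this
  have step1 : ∀ m, S ≤ m → m ≤ l → m ≤ h →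
      ∫⁻ x in solidCylinder S S, ∫⁻ z in solidCylinder m m, ‖u x - u z‖ₑ ^ 2 ≤
        ENNReal.ofReal (66 * S ^ 2) * E * volume (solidCylinder m m) := by
    intro m hSm hml hmh
    have hm : 0 < m := hS.trans_le hSm
    have hA : 1 ≤ m / S := (one_le_div hS).2 hSm
    have hfl := setLIntegral_sub_smul_sq_le hS hA hu
    have hst := lintegral_lintegral_sub_sq_stretch_le volume (P := ContinuousLinearMap.id ℝ _)
      (A := m / S) (δ := (m / S) ^ 3) (by positivity) (by rw [det_stretch_id]; simp)
      (Q := solidCylinder S S) (B := solidCylinder S S)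
      (B' := solidCylinder (m / S * S) (m / S * S)) (isOpen_solidCylinder _ _).measurableSet
      (fun x => by rw [stretch_id_apply]; exact smul_mem_solidCylinder_iff (by positivity) x)
      hu.continuous
      (κ := ENNReal.ofReal (32 * S ^ 2) * E) (φ := ENNReal.ofReal (S ^ 2) * E)
      (by
        refine (setLIntegral_cube_sub_sq_le hS hu).trans ?_
        rw [mul_right_comm]
        gcongr
        exact hEmono _ _ hS.le hSl hSh)
      (by
        refine mul_le_mul' (hfl.trans ?_) le_rfl
        gcongr
        rw [div_mul_cancel₀ _ hS.ne']
        exact hEmono _ _ hm.le hml hmh)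
    rw [div_mul_cancel₀ _ hS.ne'] at hst
    refine hst.trans (le_of_eq ?_)
    rw [show 66 * S ^ 2 = 2 * (32 * S ^ 2) + 2 * S ^ 2 by ring,
      ENNReal.ofReal_add (by positivity) (by positivity), ENNReal.ofReal_mul zero_le_two,
      ENNReal.ofReal_mul zero_le_two, ENNReal.ofReal_ofNat]
    ring
  have hfin : ENNReal.ofReal (134 * S ^ 2) * E =
      2 * (ENNReal.ofReal (66 * S ^ 2) * E) + 2 * (ENNReal.ofReal (S ^ 2) * E) := by
    rw [show 134 * S ^ 2 = 2 * (66 * S ^ 2) + 2 * S ^ 2 by ring,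
      ENNReal.ofReal_add (by positivity) (by positivity), ENNReal.ofReal_mul zero_le_two,
      ENNReal.ofReal_mul zero_le_two, ENNReal.ofReal_ofNat]
    ring
  -- A stretch starting from C(m,m) with cost t is weighted by the volume ratio (S/m)³. The
  -- conditions `hlog` and `hlin` make this weighted cost at most S² in the horizontal and the
  -- vertical case respectively.
  have hφ : ∀ m t : ℝ, 0 < m → 0 ≤ t → t * (S / m) ^ 3 ≤ S ^ 2 → ∀ I : ℝ≥0∞,
      I ≤ ENNReal.ofReal t * E →
      I * volume (solidCylinder S S) ≤
        ENNReal.ofReal (S ^ 2) * E * volume (solidCylinder m m) := by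
    intro m t hm ht htS I hI
    rw [hvol m hm]
    calc _ ≤ ENNReal.ofReal t * E * (ENNReal.ofReal ((S / m) ^ 3) * volume (solidCylinder m m)) := by
          gcongr
      _ = ENNReal.ofReal (t * (S / m) ^ 3) * E * volume (solidCylinder m m) := by
          rw [ENNReal.ofReal_mul ht]; ring
      _ ≤ _ := by gcongr
  rw [hfin]
  rcases le_total h l with hhl | hlh
  · have hA : 1 ≤ l / h := (one_le_div hh).2 hhl
    have hfl := setLIntegral_sub_horizontal_sq_le (h := h) hh hA hu
    rw [div_mul_cancel₀ _ hh.ne'] at hfl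
    have hst := lintegral_lintegral_sub_sq_stretch_le volume (P := horizontalProj)
      (A := l / h) (δ := (l / h) ^ 2) (by positivity) (det_stretch_horizontalProj _)
      (Q := solidCylinder S S) (B := solidCylinder h h)
      (B' := solidCylinder (l / h * h) h) (isOpen_solidCylinder _ _).measurableSet
      (stretch_horizontalProj_mem_iff (by positivity)) hu.continuous (step1 h hSh hhl le_rfl)
      (hφ h _ hh (mul_nonneg (Real.log_nonneg hA) (by positivity)) (by
        rw [div_pow, show Real.log (l / h) * (h ^ 2 / 2) * (S ^ 3 / h ^ 3) =
          S ^ 2 * ((S * Real.log (l / h)) / (2 * h)) by field_simp]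
        refine mul_le_of_le_one_right (by positivity) ((div_le_one (by positivity)).2 hlog)) _ hfl)
    rwa [div_mul_cancel₀ _ hh.ne'] at hst
  · have hA : 1 ≤ h / l := (one_le_div hl).2 hlh
    have hfl := setLIntegral_sub_vertical_sq_le hl hl.le hA hu
    rw [div_mul_cancel₀ _ hl.ne'] at hfl
    have hst := lintegral_lintegral_sub_sq_stretch_le volume (P := verticalProj)
      (A := h / l) (δ := h / l) (by positivity) (det_stretch_verticalProj _)
      (Q := solidCylinder S S) (B := solidCylinder l l)
      (B' := solidCylinder l (h / l * l)) (isOpen_solidCylinder _ _).measurableSet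
      (stretch_verticalProj_mem_iff (by positivity)) hu.continuous (step1 l hSl le_rfl hlh)
      (hφ l _ hl (by positivity) (by
        rw [div_pow, show h / l * (l ^ 2 / 2) * (S ^ 3 / l ^ 3) =
          S ^ 2 * ((S * h) / (2 * l ^ 2)) by field_simp]
        refine mul_le_of_le_one_right (by positivity) ((div_le_one (by positivity)).2 hlin)) _ hfl)
    rwa [div_mul_cancel₀ _ hl.ne'] at hst

/-! ### Mollification in L² and smooth approximation of Sobolev functions -/

section Mollification

variable {N : ℕ} {F : Type*} [NormedAddCommGroup F]

theorem tendsto_eLpNorm_translate_sub {f : EuclideanSpace ℝ (Fin N) → F} (hf : MemLp f 2) :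
    Tendsto (fun t => eLpNorm (fun x => f (x - t) - f x) 2) (𝓝 0) (𝓝 0) := by
  have : Fact ((2 : ℝ≥0∞) ≠ ⊤) := ⟨by simp⟩
  have h1 : Continuous fun t : EuclideanSpace ℝ (Fin N) =>
      (DomAddAct.mk (-t) +ᵥ hf.toLp f : Lp F 2 volume) :=
    (DomAddAct.continuous_mk.comp continuous_neg).vadd continuous_const
  have h2 := (h1.tendsto 0).edist (tendsto_const_nhds (x := hf.toLp f))
  have h3 : (DomAddAct.mk (-(0 : EuclideanSpace ℝ (Fin N))) +ᵥ hf.toLp f : Lp F 2 volume) =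
      hf.toLp f := by rw [neg_zero, DomAddAct.mk_zero, zero_vadd]
  rw [h3, edist_self] at h2
  refine h2.congr fun t => ?_
  rw [DomAddAct.mk_vadd_toLp, Lp.edist_toLp_toLp]
  congr 1
  ext x
  simp [vadd_eq_add, sub_eq_neg_add]

variable [NormedSpace ℝ F]

theorem eLpNorm_two_sq {α G : Type*} [MeasurableSpace α] [NormedAddCommGroup G] (μ : Measure α)
    (f : α → G) : eLpNorm f 2 μ ^ 2 = ∫⁻ x, ‖f x‖ₑ ^ 2 ∂μ := by
  rw [eLpNorm_eq_lintegral_rpow_enorm_toReal (by simp) (by simp), ← ENNReal.rpow_natCast,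
    ← ENNReal.rpow_mul]
  simp

/-- The mollifier is a probability density, so Cauchy–Schwarz bounds the squared error at x by the
mean of |f(x - t) - f x|² over t; Tonelli then reduces it to translations by vectors in the support.
-/
theorem eLpNorm_mollify_sub_sq_le [CompleteSpace F] {f : EuclideanSpace ℝ (Fin N) → F}
    (hfm : StronglyMeasurable f) (hf : MemLp f 2) (φ : ContDiffBump (0 : EuclideanSpace ℝ (Fin N)))
    {ε : ℝ≥0∞}
    (hε : ∀ t ∈ Metric.ball 0 φ.rOut, eLpNorm (fun x => f (x - t) - f x) 2 ^ 2 ≤ ε) :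
    eLpNorm (fun x => (∫ t, φ.normed volume t • f (x - t)) - f x) 2 ^ 2 ≤ ε := by
  have hmass : ∫⁻ t, ENNReal.ofReal (φ.normed volume t) = 1 := by
    rw [← ofReal_integral_eq_lintegral_ofReal φ.integrable_normed
      (.of_forall φ.nonneg_normed), φ.integral_normed, ENNReal.ofReal_one]
  have hφm : Measurable fun t => ENNReal.ofReal (φ.normed volume t) :=
    ENNReal.measurable_ofReal.comp φ.continuous_normed.measurable
  have hloc : LocallyIntegrable f := hf.locallyIntegrable (by norm_num)
  have hfe : Measurable fun p : EuclideanSpace ℝ (Fin N) × EuclideanSpace ℝ (Fin N) =>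
      ‖f (p.1 - p.2) - f p.1‖ₑ :=
    ((hfm.comp_measurable (by fun_prop)).sub (hfm.comp_measurable measurable_fst)).enorm
  have hpt : ∀ x, ‖(∫ t, φ.normed volume t • f (x - t)) - f x‖ₑ ^ 2 ≤
      ∫⁻ t, ENNReal.ofReal (φ.normed volume t) * ‖f (x - t) - f x‖ₑ ^ 2 := by
    intro x
    have hint : Integrable fun t => φ.normed volume t • f (x - t) :=
      φ.hasCompactSupport_normed.convolutionExists_left (ContinuousLinearMap.lsmul ℝ ℝ)
        φ.continuous_normed hloc x
    have h1 : (∫ t, φ.normed volume t • f (x - t)) - f x =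
        ∫ t, φ.normed volume t • (f (x - t) - f x) := by
      simp only [smul_sub]
      rw [integral_sub hint (φ.integrable_normed.smul_const _), φ.integral_normed_smul]
    have hme : Measurable fun t => ‖f (x - t) - f x‖ₑ := hfe.comp measurable_prodMk_left
    have h2 := sq_lintegral_mul_le volume
      (f := fun t => ENNReal.ofReal (Real.sqrt (φ.normed volume t)))
      (g := fun t => ENNReal.ofReal (Real.sqrt (φ.normed volume t)) * ‖f (x - t) - f x‖ₑ)
      (ENNReal.measurable_ofReal.comp (φ.continuous_normed.measurable.sqrt)).aemeasurable
      ((ENNReal.measurable_ofReal.comp (φ.continuous_normed.measurable.sqrt)).mul hme).aemeasurable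
    have hsq : ∀ t, ENNReal.ofReal (Real.sqrt (φ.normed volume t)) ^ 2 =
        ENNReal.ofReal (φ.normed volume t) := fun t => by
      rw [← ENNReal.ofReal_pow (Real.sqrt_nonneg _), Real.sq_sqrt (φ.nonneg_normed t)]
    simp only [mul_pow, hsq, ← mul_assoc, ← pow_two] at h2
    rw [hmass, one_mul] at h2
    refine le_trans ?_ h2
    rw [h1]
    gcongr
    refine (enorm_integral_le_lintegral_enorm _).trans (lintegral_mono fun t => ?_)
    rw [enorm_smul, Real.enorm_of_nonneg (φ.nonneg_normed t)]
  rw [eLpNorm_two_sq]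
  calc _ ≤ ∫⁻ x, ∫⁻ t, ENNReal.ofReal (φ.normed volume t) * ‖f (x - t) - f x‖ₑ ^ 2 :=
        lintegral_mono hpt
    _ = ∫⁻ t, ∫⁻ x, ENNReal.ofReal (φ.normed volume t) * ‖f (x - t) - f x‖ₑ ^ 2 :=
        lintegral_lintegral_swap
          ((hφm.comp measurable_snd).mul (hfe.pow_const 2)).aemeasurable
    _ ≤ ∫⁻ t, ENNReal.ofReal (φ.normed volume t) * ε := by
        refine lintegral_mono fun t => ?_
        have hme : Measurable fun x => ‖f (x - t) - f x‖ₑ := hfe.comp measurable_prodMk_right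
        rw [lintegral_const_mul _ (hme.pow_const 2)]
        by_cases ht : t ∈ Metric.ball 0 φ.rOut
        · gcongr
          rw [← eLpNorm_two_sq]
          exact hε t ht
        · rw [← φ.support_normed_eq (μ := volume), Function.notMem_support] at ht
          simp [ht]
    _ = ε := by rw [lintegral_mul_const _ hφm, hmass, one_mul]

theorem tendsto_eLpNorm_mollify_sub [CompleteSpace F] {f : EuclideanSpace ℝ (Fin N) → F}
    (hf : MemLp f 2) {φ : ℕ → ContDiffBump (0 : EuclideanSpace ℝ (Fin N))}
    (hφ : Tendsto (fun n => (φ n).rOut) atTop (𝓝 0)) :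
    Tendsto (fun n => eLpNorm (fun x => (∫ t, (φ n).normed volume t • f (x - t)) - f x) 2)
      atTop (𝓝 0) := by
  -- A strongly measurable representative makes the translated difference jointly measurable, as
  -- Tonelli requires.
  wlog hfm : StronglyMeasurable f generalizing f
  · have hae := hf.1.ae_eq_mk
    refine (this ((memLp_congr_ae hae).1 hf) hf.1.stronglyMeasurable_mk).congr fun n => ?_
    refine eLpNorm_congr_ae ?_
    filter_upwards [hae] with x hx
    rw [← hx]
    congr 1
    refine integral_congr_ae ?_
    have := (quasiMeasurePreserving_sub_left_of_right_invariant volume x).ae hae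
    filter_upwards [this] with t ht
    rw [ht]
  have h0 := tendsto_eLpNorm_translate_sub hf
  rw [ENNReal.tendsto_nhds_zero] at h0 ⊢
  intro ε hε
  obtain ⟨δ, hδ, hball⟩ := Metric.eventually_nhds_iff_ball.1 (h0 ε hε)
  filter_upwards [hφ.eventually_lt_const hδ] with n hn
  refine (ENNReal.pow_le_pow_left_iff two_ne_zero).1 ?_
  exact eLpNorm_mollify_sub_sq_le hfm hf (φ n) fun t ht => by
    gcongr
    exact hball t (Metric.ball_subset_ball hn.le ht)

end Mollification

theorem continuous_gradient {N : ℕ} {u : EuclideanSpace ℝ (Fin N) → ℝ} (hu : ContDiff ℝ 1 u) :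
    Continuous (∇ u) :=
  (InnerProductSpace.toDual ℝ _).symm.continuous.comp (hu.continuous_fderiv (by simp))

theorem HasCompactSupport.gradient {N : ℕ} {u : EuclideanSpace ℝ (Fin N) → ℝ}
    (hu : HasCompactSupport u) : HasCompactSupport (∇ u) :=
  (hu.fderiv ℝ).comp_left (g := (InnerProductSpace.toDual ℝ _).symm) (map_zero _)

theorem exists_smooth_approx {N : ℕ} {U : Set (EuclideanSpace ℝ (Fin N))} (hU : IsOpen U)
    {v : EuclideanSpace ℝ (Fin N) → ℝ} {g : EuclideanSpace ℝ (Fin N) → EuclideanSpace ℝ (Fin N)}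
    (hv : IsSobolevH1 U v g) {Z : Set (EuclideanSpace ℝ (Fin N))} (hZ : IsCompact Z) (hZU : Z ⊆ U) :
    ∃ u : ℕ → EuclideanSpace ℝ (Fin N) → ℝ, (∀ n, ContDiff ℝ ∞ (u n)) ∧
      Tendsto (fun n => eLpNorm (fun x => u n x - v x) 2 (volume.restrict Z)) atTop (𝓝 0) ∧
      Tendsto (fun n => eLpNorm (fun x => ∇ (u n) x - g x) 2 (volume.restrict Z)) atTop (𝓝 0) := by
  obtain ⟨δ, hδ, hthick⟩ := hZ.exists_thickening_subset_open hU hZU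
  have hv0 : MemLp (U.indicator v) 2 := (memLp_indicator_iff_restrict hU.measurableSet).2 hv.memLp
  have hg0 : MemLp (U.indicator g) 2 :=
    (memLp_indicator_iff_restrict hU.measurableSet).2 hv.memLp_grad
  have hloc : LocallyIntegrable (U.indicator v) := hv0.locallyIntegrable (by norm_num)
  -- The outer radius δ/(n+2) is less than δ, so the kernel centred at a point of Z is supported in
  -- U and is an admissible test function.
  let φ : ℕ → ContDiffBump (0 : EuclideanSpace ℝ (Fin N)) := fun n =>
    ⟨δ / 2 / (n + 2), δ / (n + 2), by positivity, by
      have : 0 < δ / (n + 2) := by positivity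
      rw [div_right_comm]; linarith⟩
  have hφ : Tendsto (fun n => (φ n).rOut) atTop (𝓝 0) := by
    have := (tendsto_natCast_atTop_atTop (R := ℝ)).atTop_add (tendsto_const_nhds (x := (2 : ℝ)))
    exact this.const_div_atTop δ
  have hrOut : ∀ n, (φ n).rOut < δ := fun n => by
    show δ / (n + 2) < δ
    rw [div_lt_iff₀ (by positivity)]
    nlinarith [(Nat.cast_nonneg n : (0 : ℝ) ≤ n)]
  let u : ℕ → EuclideanSpace ℝ (Fin N) → ℝ := fun n =>
    convolution (U.indicator v) ((φ n).normed volume) (ContinuousLinearMap.lsmul ℝ ℝ) volume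
  have hu_eq : ∀ n x, u n x = ∫ t, (φ n).normed volume t • U.indicator v (x - t) := by
    intro n x
    simp only [u]
    rw [convolution_lsmul_swap]
    simp [mul_comm]
  have hgrad : ∀ n, ∀ x ∈ Z, ∇ (u n) x = ∫ t, (φ n).normed volume t • U.indicator g (x - t) := by
    intro n x hx
    set ρ := (φ n).normed volume with hρ
    have hρ1 : ContDiff ℝ ∞ ρ := (φ n).contDiff_normed
    have hρc : HasCompactSupport ρ := (φ n).hasCompactSupport_normed
    have hρd : Differentiable ℝ ρ := hρ1.differentiable (by simp)
    -- Testing the weak gradient against the reflected kernel s ↦ ρ(x - s), whose gradient is -∇ρ(x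
    -- - s), moves the derivative from the kernel to v.
    set ψ : EuclideanSpace ℝ (Fin N) → ℝ := fun s => ρ (x - s) with hψ
    have hψ1 : ContDiff ℝ ∞ ψ := hρ1.comp (contDiff_const.sub contDiff_id)
    have hψc : HasCompactSupport ψ := hρc.comp_homeomorph (Homeomorph.subLeft x)
    have hψU : tsupport ψ ⊆ U := by
      refine Subset.trans ?_ hthick
      refine Subset.trans (closure_minimal (t := Metric.closedBall x (φ n).rOut) ?_
        Metric.isClosed_closedBall) ?_
      · intro s hs
        have : x - s ∈ Function.support ρ := hs
        rw [(φ n).support_normed_eq, mem_ball_zero_iff, ← dist_eq_norm] at this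
        rw [Metric.mem_closedBall, dist_comm]; exact this.le
      · exact (Metric.closedBall_subset_ball (hrOut n)).trans (Metric.ball_subset_thickening hx δ)
    have hψg : ∀ s, ∇ ψ s = -∇ ρ (x - s) := by
      intro s
      refine ext_inner_right ℝ fun y => ?_
      rw [inner_neg_left, inner_gradient_left, inner_gradient_left]
      have := ((hρd (x - s)).hasFDerivAt.comp s ((hasFDerivAt_id s).const_sub x)).fderiv
      have h2 : fderiv ℝ ψ s = _ := this
      rw [h2]; simp
    have hweak := hv.hasWeakGradient.2.2 ψ hψ1 hψc hψU
    have hfd := hρc.hasFDerivAt_convolution_right (ContinuousLinearMap.lsmul ℝ ℝ) hloc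
      (hρ1.of_le (by simp)) x
    have hconv : Integrable fun s => U.indicator v s • ∇ ρ (x - s) :=
      hρc.gradient.convolutionExists_right (ContinuousLinearMap.lsmul ℝ ℝ) hloc
        (continuous_gradient (hρ1.of_le (by simp))) x
    refine ext_inner_left ℝ fun y => ?_
    have h1 : ∫ s, U.indicator v s • ∇ ρ (x - s) = ∫ t, ρ t • U.indicator g (x - t) := by
      calc _ = - ∫ s in U, v s • ∇ ψ s := by
            rw [← integral_neg, ← integral_indicator hU.measurableSet]
            refine integral_congr_ae (.of_forall fun s => ?_)
            by_cases hs : s ∈ U <;> simp [hs, hψg]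
        _ = ∫ s in U, ψ s • g s := by rw [hweak, neg_neg]
        _ = ∫ s, ρ (x - s) • U.indicator g (x - (x - s)) := by
            rw [← integral_indicator hU.measurableSet]
            refine integral_congr_ae (.of_forall fun s => ?_)
            by_cases hs : s ∈ U <;> simp [hs, hψ]
        _ = _ := integral_sub_left_eq_self (fun t => ρ t • U.indicator g (x - t)) volume x
    rw [inner_gradient_right, hfd.fderiv, convolution_precompR_apply _ hloc (hρc.fderiv ℝ)
      (hρ1.continuous_fderiv (by simp)), ← h1, ← integral_inner hconv]
    simp only [convolution_def, ContinuousLinearMap.lsmul_apply, inner_smul_right,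
      inner_gradient_right, smul_eq_mul, conj_trivial]
  refine ⟨u, fun n => ?_, ?_, ?_⟩
  · exact (φ n).hasCompactSupport_normed.contDiff_convolution_right _ hloc (φ n).contDiff_normed
  · refine tendsto_of_tendsto_of_tendsto_of_le_of_le tendsto_const_nhds
      (tendsto_eLpNorm_mollify_sub hv0 hφ) (fun _ => bot_le) (fun n => ?_)
    refine le_trans (le_of_eq ?_) (eLpNorm_mono_measure _ (Measure.restrict_le_self (s := Z)))
    refine eLpNorm_congr_ae ?_
    filter_upwards [ae_restrict_mem hZ.measurableSet] with x hx
    rw [hu_eq, indicator_of_mem (hZU hx)]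
  · refine tendsto_of_tendsto_of_tendsto_of_le_of_le tendsto_const_nhds
      (tendsto_eLpNorm_mollify_sub hg0 hφ) (fun _ => bot_le) (fun n => ?_)
    refine le_trans (le_of_eq ?_) (eLpNorm_mono_measure _ (Measure.restrict_le_self (s := Z)))
    refine eLpNorm_congr_ae ?_
    filter_upwards [ae_restrict_mem hZ.measurableSet] with x hx
    rw [hgrad n x hx, indicator_of_mem (hZU hx)]

/-! ### From smooth functions to H¹: comparison with the average -/

theorem enorm_gradient {N : ℕ} (u : EuclideanSpace ℝ (Fin N) → ℝ) (x : EuclideanSpace ℝ (Fin N)) :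
    ‖∇ u x‖ₑ = ‖fderiv ℝ u x‖ₑ := by
  rw [← toDual_gradient, LinearIsometryEquiv.enorm_map]

theorem closure_solidCylinder_mul_subset {l h r : ℝ} (hl : 0 < l) (hh : 0 < h) (hr0 : 0 < r)
    (hr : r < 1) : closure (solidCylinder (r * l) (r * h)) ⊆ solidCylinder l h := by
  have hcl : IsClosed {x : EuclideanSpace ℝ (Fin 3) |
      x 0 ^ 2 + x 1 ^ 2 ≤ (r * l) ^ 2 ∧ -(r * h) ≤ x 2 ∧ x 2 ≤ r * h} := by
    have h1 : IsClosed {x : EuclideanSpace ℝ (Fin 3) | x 0 ^ 2 + x 1 ^ 2 ≤ (r * l) ^ 2} :=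
      isClosed_le (by fun_prop) (by fun_prop)
    have h2 : IsClosed {x : EuclideanSpace ℝ (Fin 3) | -(r * h) ≤ x 2} :=
      isClosed_le (by fun_prop) (by fun_prop)
    have h3 : IsClosed {x : EuclideanSpace ℝ (Fin 3) | x 2 ≤ r * h} :=
      isClosed_le (by fun_prop) (by fun_prop)
    exact h1.inter (h2.inter h3)
  have hsub : solidCylinder (r * l) (r * h) ⊆ {x : EuclideanSpace ℝ (Fin 3) |
      x 0 ^ 2 + x 1 ^ 2 ≤ (r * l) ^ 2 ∧ -(r * h) ≤ x 2 ∧ x 2 ≤ r * h} :=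
    fun x hx => ⟨hx.1.le, hx.2.1.le, hx.2.2.le⟩
  refine (closure_minimal hsub hcl).trans ?_
  rintro x ⟨h1, h2, h3⟩
  have h4 : r * h < h := by nlinarith
  have h5 : r * l < l := by nlinarith
  refine ⟨h1.trans_lt (by gcongr), by linarith, by linarith⟩

theorem lintegral_lintegral_sub_sq_le_of_approx {α : Type*} [MeasurableSpace α] {μ ν : Measure α}
    [SFinite ν] {u v : α → ℝ} (hu : Measurable u) (hμ : AEMeasurable v μ) (hν : AEMeasurable v ν) :
    ∫⁻ x, ∫⁻ z, ‖v x - v z‖ₑ ^ 2 ∂ν ∂μ ≤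
      2 * (ν univ * eLpNorm (fun x => u x - v x) 2 μ ^ 2) +
        (4 * (∫⁻ x, ∫⁻ z, ‖u x - u z‖ₑ ^ 2 ∂ν ∂μ) +
          4 * (μ univ * eLpNorm (fun x => u x - v x) 2 ν ^ 2)) := by
  have hm : Measurable fun x => ∫⁻ z, ‖u x - u z‖ₑ ^ 2 ∂ν :=
    Measurable.lintegral_prod_right' (f := fun p : α × α => ‖u p.1 - u p.2‖ₑ ^ 2) (by fun_prop)
  calc _ ≤ ∫⁻ x, ∫⁻ z, (2 * ‖u x - v x‖ₑ ^ 2 + (4 * ‖u x - u z‖ₑ ^ 2 +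
        4 * ‖u z - v z‖ₑ ^ 2)) ∂ν ∂μ := by
        gcongr with x z
        refine (enorm_sub_sq_le_two_mul (v x) (u x) (v z)).trans ?_
        rw [← enorm_neg (v x - u x), neg_sub]
        gcongr
        calc _ ≤ 2 * (2 * ‖u x - u z‖ₑ ^ 2 + 2 * ‖u z - v z‖ₑ ^ 2) := by
              gcongr; exact enorm_sub_sq_le_two_mul _ _ _
          _ = _ := by ring
    _ = ∫⁻ x, (2 * (ν univ * ‖u x - v x‖ₑ ^ 2) + (4 * (∫⁻ z, ‖u x - u z‖ₑ ^ 2 ∂ν) +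
          4 * eLpNorm (fun x => u x - v x) 2 ν ^ 2)) ∂μ := by
        refine lintegral_congr fun x => ?_
        have h1 : ∫⁻ z, 4 * ‖u z - v z‖ₑ ^ 2 ∂ν = 4 * ∫⁻ z, ‖u z - v z‖ₑ ^ 2 ∂ν :=
          lintegral_const_mul'' _ (by fun_prop)
        have h2 : ∫⁻ z, 4 * ‖u x - u z‖ₑ ^ 2 ∂ν = 4 * ∫⁻ z, ‖u x - u z‖ₑ ^ 2 ∂ν :=
          lintegral_const_mul _ (by fun_prop)
        rw [lintegral_add_left measurable_const, lintegral_add_left (by fun_prop), h1, h2, lintegral_const, eLpNorm_two_sq]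
        ring
    _ = _ := by
        have h1 : ∫⁻ x, 2 * (ν univ * ‖u x - v x‖ₑ ^ 2) ∂μ =
            2 * (ν univ * ∫⁻ x, ‖u x - v x‖ₑ ^ 2 ∂μ) := by
          rw [lintegral_const_mul'' _ (by fun_prop), lintegral_const_mul'' _ (by fun_prop)]
        rw [lintegral_add_left' (by fun_prop), lintegral_add_left (by fun_prop), h1,
          lintegral_const_mul _ hm, lintegral_const, eLpNorm_two_sq μ]
        ring

/-- Smooth approximants exist only on compact subsets of the cylinder, hence the shrinking factor r.
Replacing v by an approximant at both points costs a factor 4 on the smooth term, and 4 · 134 = 536;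
the other errors vanish in the limit. -/
theorem IsSobolevH1.setLIntegral_sub_sq_le_inner {S l h r : ℝ}
    {v : EuclideanSpace ℝ (Fin 3) → ℝ} {g : EuclideanSpace ℝ (Fin 3) → EuclideanSpace ℝ (Fin 3)}
    (hv : IsSobolevH1 (solidCylinder l h) v g)
    (hS : 0 < S) (hr0 : 0 < r) (hr : r < 1) (hSl : S ≤ r * l) (hSh : S ≤ r * h)
    (hlog : S * Real.log (l / h) ≤ 2 * (r * h)) (hlin : S * h ≤ 2 * (r * l ^ 2)) :
    ∫⁻ x in solidCylinder S S, ∫⁻ z in solidCylinder (r * l) (r * h), ‖v x - v z‖ₑ ^ 2 ≤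
      ENNReal.ofReal (536 * S ^ 2) * (∫⁻ z in solidCylinder l h, ‖g z‖ₑ ^ 2) *
        volume (solidCylinder l h) := by
  have hl : 0 < l := pos_of_mul_pos_right (hS.trans_le hSl) hr0.le
  have hh : 0 < h := pos_of_mul_pos_right (hS.trans_le hSh) hr0.le
  set U := solidCylinder l h with hU
  set C := solidCylinder (r * l) (r * h) with hC
  set Q := solidCylinder S S with hQ
  have hcl : closure C ⊆ U := closure_solidCylinder_mul_subset hl hh hr0 hr
  have hCU : C ⊆ U := subset_closure.trans hcl
  have hQC : Q ⊆ C := solidCylinder_mono hS.le hSl hSh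
  have hvm : AEMeasurable v (volume.restrict U) := hv.memLp.1.aemeasurable
  obtain ⟨u, hu, hu1, hu2⟩ := exists_smooth_approx (isOpen_solidCylinder l h) hv
    (isBounded_solidCylinder _ _).isCompact_closure hcl
  have hsub : ∀ s ⊆ closure C, Tendsto (fun n => eLpNorm (fun x => u n x - v x) 2
      (volume.restrict s)) atTop (𝓝 0) := fun s hs =>
    tendsto_of_tendsto_of_tendsto_of_le_of_le tendsto_const_nhds hu1 (fun _ => bot_le)
      (fun n => eLpNorm_mono_measure _ (Measure.restrict_mono hs le_rfl))
  have hbound : ∀ n, ∫⁻ x in Q, ∫⁻ z in C, ‖v x - v z‖ₑ ^ 2 ≤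
      2 * (volume C * eLpNorm (fun x => u n x - v x) 2 (volume.restrict Q) ^ 2) +
        (4 * (ENNReal.ofReal (134 * S ^ 2) * (eLpNorm g 2 (volume.restrict U) +
          eLpNorm (fun x => ∇ (u n) x - g x) 2 (volume.restrict (closure C))) ^ 2 * volume U) +
          4 * (volume Q * eLpNorm (fun x => u n x - v x) 2 (volume.restrict C) ^ 2)) := by
    intro n
    have hun : ContDiff ℝ 1 (u n) := (hu n).of_le (by simp)
    refine (lintegral_lintegral_sub_sq_le_of_approx (u := u n) (hu n).continuous.measurable
      (hvm.mono_measure (Measure.restrict_mono (hQC.trans hCU) le_rfl))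
      (hvm.mono_measure (Measure.restrict_mono hCU le_rfl))).trans ?_
    simp only [Measure.restrict_apply_univ]
    gcongr
    refine (setLIntegral_solidCylinder_sub_sq_le hS hSl hSh ?_ ?_ hun).trans ?_
    · rwa [mul_div_mul_left _ _ hr0.ne']
    · nlinarith
    · gcongr
      simp only [← enorm_gradient]
      rw [← eLpNorm_two_sq]
      gcongr
      have hgm : AEStronglyMeasurable g (volume.restrict C) :=
        hv.memLp_grad.1.mono_measure (Measure.restrict_mono hCU le_rfl)
      have hdm : AEStronglyMeasurable (fun x => ∇ (u n) x - g x) (volume.restrict C) :=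
        (continuous_gradient hun).aestronglyMeasurable.sub hgm
      have hsum : ∇ (u n) = g + fun x => ∇ (u n) x - g x := by ext1 x; simp
      calc eLpNorm (∇ (u n)) 2 (volume.restrict C) =
            eLpNorm (g + fun x => ∇ (u n) x - g x) 2 (volume.restrict C) := by
            rw [← hsum]
        _ ≤ _ := eLpNorm_add_le hgm hdm (by norm_num)
        _ ≤ _ := add_le_add (eLpNorm_mono_measure _ (Measure.restrict_mono hCU le_rfl))
            (eLpNorm_mono_measure _ (Measure.restrict_mono subset_closure le_rfl))
  have hlim : Tendsto (fun n =>
      2 * (volume C * eLpNorm (fun x => u n x - v x) 2 (volume.restrict Q) ^ 2) +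
        (4 * (ENNReal.ofReal (134 * S ^ 2) * (eLpNorm g 2 (volume.restrict U) +
          eLpNorm (fun x => ∇ (u n) x - g x) 2 (volume.restrict (closure C))) ^ 2 * volume U) +
          4 * (volume Q * eLpNorm (fun x => u n x - v x) 2 (volume.restrict C) ^ 2))) atTop
      (𝓝 (2 * (volume C * 0 ^ 2) + (4 * (ENNReal.ofReal (134 * S ^ 2) *
        (eLpNorm g 2 (volume.restrict U) + 0) ^ 2 * volume U) + 4 * (volume Q * 0 ^ 2)))) := by
    have hpow : ∀ {f : ℕ → ℝ≥0∞} {a : ℝ≥0∞}, Tendsto f atTop (𝓝 a) →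
        Tendsto (fun n => f n ^ 2) atTop (𝓝 (a ^ 2)) := fun h => ENNReal.Tendsto.pow h
    have hQt := volume_solidCylinder_lt_top S S
    have hCt := volume_solidCylinder_lt_top (r * l) (r * h)
    have hUt := volume_solidCylinder_lt_top l h
    refine ((ENNReal.Tendsto.const_mul (ENNReal.Tendsto.const_mul
      (hpow (hsub _ (hQC.trans subset_closure))) (.inr hCt.ne)) (.inr (by simp))).add
      ((ENNReal.Tendsto.const_mul (ENNReal.Tendsto.mul_const (ENNReal.Tendsto.const_mul
        (hpow (tendsto_const_nhds.add hu2)) (.inr ENNReal.ofReal_ne_top)) (.inr hUt.ne)) (.inr (by simp))).add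
      (ENNReal.Tendsto.const_mul (ENNReal.Tendsto.const_mul
      (hpow (hsub _ subset_closure)) (.inr hQt.ne)) (.inr (by simp)))))
  refine (ge_of_tendsto' hlim hbound).trans (le_of_eq ?_)
  rw [add_zero, eLpNorm_two_sq, show 536 * S ^ 2 = 4 * (134 * S ^ 2) by ring,
    ENNReal.ofReal_mul (p := 4) (by norm_num), ENNReal.ofReal_ofNat]
  ring

/-- Jensen's inequality: the integral of b - v is μ(univ) times b minus the average, and
Cauchy–Schwarz against the constant 1 bounds its square. -/
theorem measure_mul_enorm_sub_average_sq_le {α : Type*} [MeasurableSpace α] {μ : Measure α}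
    [IsFiniteMeasure μ] [NeZero μ] {v : α → ℝ} (hv : Integrable v μ) (b : ℝ) :
    μ univ * ‖b - ⨍ z, v z ∂μ‖ₑ ^ 2 ≤ ∫⁻ z, ‖b - v z‖ₑ ^ 2 ∂μ := by
  have hμ : μ univ ≠ 0 := (NeZero.ne (μ univ))
  have h1 : ∫ z, (b - v z) ∂μ = μ.real univ * (b - ⨍ z, v z ∂μ) := by
    rw [integral_sub (integrable_const b) hv, integral_const, mul_sub, ← smul_eq_mul (μ.real univ)
      (⨍ z, v z ∂μ), measure_smul_average, smul_eq_mul]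
  have h2 : (μ univ * ‖b - ⨍ z, v z ∂μ‖ₑ) ^ 2 ≤ μ univ * ∫⁻ z, ‖b - v z‖ₑ ^ 2 ∂μ := by
    have h3 := sq_lintegral_mul_le μ (f := fun _ => 1) (g := fun z => ‖b - v z‖ₑ)
      measurable_const.aemeasurable ((hv.1.aemeasurable.const_sub b).enorm)
    simp only [one_mul, one_pow, lintegral_const] at h3
    refine le_trans ?_ h3
    gcongr
    refine le_trans (le_of_eq ?_) (enorm_integral_le_lintegral_enorm _)
    rw [h1, enorm_mul, Real.enorm_of_nonneg measureReal_nonneg, ofReal_measureReal]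
  rw [mul_pow, pow_two (μ univ), mul_assoc] at h2
  exact (ENNReal.mul_le_mul_iff_right hμ (measure_ne_top _ _)).1 h2

theorem IsSobolevH1.setLIntegral_sub_average_sq_le {S l h : ℝ}
    {v : EuclideanSpace ℝ (Fin 3) → ℝ} {g : EuclideanSpace ℝ (Fin 3) → EuclideanSpace ℝ (Fin 3)}
    (hv : IsSobolevH1 (solidCylinder l h) v g)
    (hS : 0 < S) (hSl : 2 * S ≤ l) (hSh : 2 * S ≤ h)
    (hlog : S * Real.log (l / h) ≤ h) (hlin : S * h ≤ l ^ 2) :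
    ∫⁻ x in solidCylinder S S, ‖v x - ⨍ z in solidCylinder l h, v z‖ₑ ^ 2 ≤
      ENNReal.ofReal (536 * S ^ 2) * ∫⁻ z in solidCylinder l h, ‖g z‖ₑ ^ 2 := by
  have hl : 0 < l := by linarith
  have hh : 0 < h := by linarith
  set U := solidCylinder l h with hU
  set Q := solidCylinder S S with hQ
  have hQU : Q ⊆ U := solidCylinder_mono hS.le (by linarith) (by linarith)
  have hvm : AEMeasurable v (volume.restrict U) := hv.memLp.1.aemeasurable
  have hvQ : AEMeasurable v (volume.restrict Q) :=
    hvm.mono_measure (Measure.restrict_mono hQU le_rfl)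
  have hUt : volume U ≠ ⊤ := (volume_solidCylinder_lt_top l h).ne
  have hU0 : volume U ≠ 0 := (volume_solidCylinder_pos hl hh).ne'
  -- These factors increase to 1 and stay at least 1/2; the factors 2 in the conditions required on
  -- the shrunken cylinders absorb this loss.
  set r : ℕ → ℝ := fun n => 1 - 1 / ((n : ℝ) + 2) with hr
  have hr1 : ∀ n, r n < 1 := fun n => by
    have : 0 < 1 / ((n : ℝ) + 2) := by positivity
    simp only [hr]; linarith
  have hr2 : ∀ n, 1 / 2 ≤ r n := fun n => by
    have : 1 / ((n : ℝ) + 2) ≤ 1 / 2 := by gcongr; linarith [(Nat.cast_nonneg n : (0 : ℝ) ≤ n)]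
    simp only [hr]; linarith
  have hrm : Monotone r := fun m n hmn => by
    simp only [hr]; gcongr
  have hrt : Tendsto r atTop (𝓝 1) := by
    have := (tendsto_natCast_atTop_atTop (R := ℝ)).atTop_add (tendsto_const_nhds (x := (2 : ℝ)))
    simpa [hr] using (this.const_div_atTop 1).const_sub 1
  have hUnion : ⋃ n, solidCylinder (r n * l) (r n * h) = U := by
    refine Subset.antisymm (iUnion_subset fun n => ?_) fun x hx => ?_
    · have := hr2 n
      exact solidCylinder_mono (by nlinarith) (by nlinarith [hr1 n]) (by nlinarith [hr1 n])
    · have h1 : ∀ᶠ n in atTop, x 0 ^ 2 + x 1 ^ 2 < (r n * l) ^ 2 :=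
        ((hrt.mul_const l).pow 2).eventually_const_lt (by simpa using hx.1)
      have h2 : ∀ᶠ n in atTop, -(r n * h) < x 2 :=
        (hrt.mul_const h).neg.eventually_lt_const (by simpa using hx.2.1)
      have h3 : ∀ᶠ n in atTop, x 2 < r n * h :=
        (hrt.mul_const h).eventually_const_lt (by simpa using hx.2.2)
      obtain ⟨n, hn1, hn2, hn3⟩ := (h1.and (h2.and h3)).exists
      exact mem_iUnion.2 ⟨n, hn1, hn2, hn3⟩
  have hjoint : ∀ C ⊆ U, AEMeasurable (Function.uncurry fun x z => ‖v x - v z‖ₑ ^ 2)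
      ((volume.restrict Q).prod (volume.restrict C)) := fun C hC => by
    have h1 := (hvQ.comp_fst (ν := volume.restrict C))
    have h2 := (hvm.mono_measure (Measure.restrict_mono hC le_rfl)).comp_snd
      (μ := volume.restrict Q)
    exact (h1.sub h2).enorm.pow_const 2
  have hfull : ∫⁻ x in Q, ∫⁻ z in U, ‖v x - v z‖ₑ ^ 2 ≤
      ENNReal.ofReal (536 * S ^ 2) * (∫⁻ z in U, ‖g z‖ₑ ^ 2) * volume U := by
    -- The variable ranging over U is put outside, so that the increasing exhaustion becomes a
    -- supremum of integrals.
    rw [lintegral_lintegral_swap (hjoint U subset_rfl)]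
    conv_lhs => rw [← hUnion]
    rw [setLIntegral_iUnion_of_directed]
    · refine iSup_le fun n => ?_
      have := hr2 n
      rw [← lintegral_lintegral_swap (hjoint _ ((subset_iUnion _ n).trans hUnion.subset))]
      exact hv.setLIntegral_sub_sq_le_inner hS (by linarith) (hr1 n) (by nlinarith) (by nlinarith)
        (by nlinarith) (by nlinarith [sq_nonneg l])
    · refine (monotone_nat_of_le_succ fun n => ?_).directed_le
      have h1 := hrm n.le_succ
      have h2 := hr2 n
      exact solidCylinder_mono (by nlinarith) (by gcongr) (by gcongr)
  have : IsFiniteMeasure (volume.restrict U) := ⟨by simpa using hUt.lt_top⟩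
  have : NeZero (volume.restrict U) := ⟨by simpa using hU0⟩
  have hint : Integrable v (volume.restrict U) := hv.memLp.integrable (by norm_num)
  have hJ : volume U * ∫⁻ x in Q, ‖v x - ⨍ z in U, v z‖ₑ ^ 2 ≤
      ∫⁻ x in Q, ∫⁻ z in U, ‖v x - v z‖ₑ ^ 2 := by
    rw [← lintegral_const_mul'' _ (((hvQ.sub_const _).enorm).pow_const 2)]
    refine lintegral_mono fun x => ?_
    simpa using measure_mul_enorm_sub_average_sq_le hint (v x)
  have h2 := hJ.trans hfull
  rw [mul_comm _ (volume U)] at h2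
  exact (ENNReal.mul_le_mul_iff_right hU0 hUt).1 h2

/-! ### Cutoffs and the lower energy bound by capacity -/

section Capacity

variable {N : ℕ}

local notation "𝔼" => EuclideanSpace ℝ (Fin N)

theorem eLpNorm_le_mul_eLpNorm_restrict {α F G : Type*} [MeasurableSpace α] [NormedAddCommGroup F]
    [NormedAddCommGroup G] {μ : Measure α} {s : Set α} (hs : MeasurableSet s) {f : α → F}
    {k : α → G} {M : ℝ} (hk : ∀ x, ‖k x‖ ≤ M * ‖f x‖) (hks : ∀ x ∉ s, k x = 0) (p : ℝ≥0∞) :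
    eLpNorm k p μ ≤ ENNReal.ofReal M * eLpNorm f p (μ.restrict s) := by
  have h1 : s.indicator k = k := indicator_eq_self.2 fun x hx => by
    by_contra hxs
    exact hx (hks x hxs)
  rw [← h1, eLpNorm_indicator_eq_eLpNorm_restrict hs]
  exact eLpNorm_le_mul_eLpNorm_of_ae_le_mul (.of_forall hk) p

theorem exists_smooth_cutoff {A O : Set 𝔼} (hA : IsCompact A) (hO : IsOpen O) (hAO : A ⊆ O) :
    ∃ χ : 𝔼 → ℝ, ContDiff ℝ ∞ χ ∧ HasCompactSupport χ ∧ tsupport χ ⊆ O ∧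
      ∀ᶠ x in 𝓝ˢ A, χ x = 1 := by
  obtain ⟨L, hL, hAL, hLO⟩ := exists_compact_between hA hO hAO
  obtain ⟨f, hf1, hf0, -⟩ := exists_contMDiffMap_one_nhds_of_subset_interior
    (modelWithCornersSelf ℝ 𝔼) (n := ⊤) hA.isClosed hAL
  have hsupp : tsupport f ⊆ L := closure_minimal (fun x hx => by
    by_contra hxL
    exact hx (hf0 x hxL)) hL.isClosed
  exact ⟨f, f.contMDiff.contDiff, hL.of_isClosed_subset (isClosed_tsupport _) hsupp,
    hsupp.trans hLO, hf1⟩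

theorem contDiff_mul_of_tsupport_subset {O : Set 𝔼} (hO : IsOpen O) {χ w : 𝔼 → ℝ}
    (hχ : ContDiff ℝ ∞ χ) (hχO : tsupport χ ⊆ O) (hw : ContDiffOn ℝ ∞ w O) :
    ContDiff ℝ ∞ fun x => χ x * w x := by
  rw [contDiff_iff_contDiffAt]
  intro x
  by_cases hx : x ∈ tsupport χ
  · exact hχ.contDiffAt.mul (hw.contDiffAt (hO.mem_nhds (hχO hx)))
  · refine contDiffAt_const (c := (0 : ℝ)) |>.congr_of_eventuallyEq ?_
    filter_upwards [notMem_tsupport_iff_eventuallyEq.1 hx] with y hy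
    simp [hy]

theorem gradient_mul {a b : 𝔼 → ℝ} {x : 𝔼} (ha : DifferentiableAt ℝ a x)
    (hb : DifferentiableAt ℝ b x) :
    ∇ (fun y => a y * b y) x = a x • ∇ b x + b x • ∇ a x := by
  refine ext_inner_right ℝ fun y => ?_
  rw [inner_gradient_left, fderiv_fun_mul ha hb]
  simp [inner_add_left, inner_smul_left, inner_gradient_left]

theorem gradient_add {a b : 𝔼 → ℝ} {x : 𝔼} (ha : DifferentiableAt ℝ a x)
    (hb : DifferentiableAt ℝ b x) : ∇ (fun y => a y + b y) x = ∇ a x + ∇ b x := by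
  refine ext_inner_right ℝ fun y => ?_
  rw [inner_gradient_left, fderiv_fun_add ha hb]
  simp [inner_add_left, inner_gradient_left]

theorem gradient_add_const {a : 𝔼 → ℝ} {x : 𝔼} (c : ℝ) :
    ∇ (fun y => a y + c) x = ∇ a x := by
  refine ext_inner_right ℝ fun y => ?_
  rw [inner_gradient_left, fderiv_add_const, inner_gradient_left]

theorem gradient_eq_zero_of_notMem_tsupport {a : 𝔼 → ℝ} {x : 𝔼} (hx : x ∉ tsupport a) :
    ∇ a x = 0 := by
  rw [(notMem_tsupport_iff_eventuallyEq.1 hx).gradient_eq]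
  exact gradient_const x 0

theorem gradient_mul_of_tsupport_subset {O : Set 𝔼} (hO : IsOpen O) {χ w : 𝔼 → ℝ}
    (hχ : ContDiff ℝ ∞ χ) (hχO : tsupport χ ⊆ O) (hw : ContDiffOn ℝ ∞ w O) (x : 𝔼) :
    ∇ (fun y => χ y * w y) x = χ x • ∇ w x + w x • ∇ χ x := by
  by_cases hx : x ∈ tsupport χ
  · exact gradient_mul (hχ.differentiable (by simp) x)
      ((hw.contDiffAt (hO.mem_nhds (hχO hx))).differentiableAt (by simp))
  · have h0 : (fun y => χ y * w y) =ᶠ[𝓝 x] fun _ => 0 := by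
      filter_upwards [notMem_tsupport_iff_eventuallyEq.1 hx] with y hy
      simp [hy]
    rw [h0.gradient_eq, gradient_eq_zero_of_notMem_tsupport hx, image_eq_zero_of_notMem_tsupport hx]
    simp

/-- Division by b turns f into a competitor for the capacity. -/
theorem harmonicCapacity_le {K : Set 𝔼} {f : 𝔼 → ℝ} (hf : ContDiff ℝ ∞ f)
    (hfc : HasCompactSupport f) {b : ℝ} (hb : 0 < b) (hfK : ∀ x ∈ K, ∀ᶠ y in 𝓝 x, f y = b) :
    ENNReal.ofReal (b ^ 2 * harmonicCapacity K univ) ≤ eLpNorm (∇ f) 2 ^ 2 := by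
  have hgrad : ∀ x, ∇ (fun y => b⁻¹ * f y) x = b⁻¹ • ∇ f x := fun x => by
    rw [gradient_mul (differentiableAt_const _) (hf.differentiable (by simp) x), gradient_fun_const]
    simp
  have hle : harmonicCapacity K univ ≤ ∫ x, ‖∇ (fun y => b⁻¹ * f y) x‖ ^ 2 := by
    refine csInf_le ⟨0, ?_⟩ ⟨fun y => b⁻¹ * f y, contDiff_const.mul hf, hfc.mul_left,
      subset_univ _, ?_, by rw [Measure.restrict_univ]⟩
    · rintro E ⟨v, -, -, -, -, rfl⟩
      positivity
    · intro x hx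
      rw [mem_interior_iff_mem_nhds]
      filter_upwards [hfK x hx] with y hy
      simp [hy, hb.ne']
  have hcont := continuous_gradient (hf.of_le (by simp) : ContDiff ℝ 1 f)
  have hint : Integrable fun x => ‖∇ f x‖ ^ 2 := by
    refine (hcont.norm.pow 2).integrable_of_hasCompactSupport (hfc.gradient.mono fun x hx h => ?_)
    exact hx (by simp [h])
  calc _ ≤ ENNReal.ofReal (∫ x, ‖∇ f x‖ ^ 2) := by
        refine ENNReal.ofReal_le_ofReal ?_
        simp only [hgrad, norm_smul, mul_pow] at hle
        rw [integral_const_mul, norm_inv, Real.norm_of_nonneg hb.le, inv_pow] at hle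
        rwa [inv_mul_eq_div, le_div_iff₀' (by positivity)] at hle
    _ = _ := by
        rw [ofReal_integral_eq_lintegral_ofReal hint (.of_forall fun x => by positivity),
          eLpNorm_two_sq]
        refine lintegral_congr fun x => ?_
        rw [ENNReal.ofReal_pow (norm_nonneg _), ofReal_norm]

/-- The right side is the energy of η(v - m). This function is approximated by smooth ones with
value exactly 1 - m near K: the given w n are used near K, where they vanish around each point of K,
and mollifications of v are used elsewhere, since mollifying near K would destroy the constant
value. -/
theorem IsSobolevH1.ofReal_mul_harmonicCapacity_le {U : Set 𝔼} (hU : IsOpen U) {v : 𝔼 → ℝ}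
    {g : 𝔼 → 𝔼} (hv : IsSobolevH1 U v g) {K : Set 𝔼} (hK : Bornology.IsBounded K)
    (hKU : closure K ⊆ U) (hw : EqWeakly U v g 1 K) {η : 𝔼 → ℝ} (hη : ContDiff ℝ ∞ η)
    (hηc : HasCompactSupport η) (hηU : tsupport η ⊆ U) (hη1 : ∀ᶠ x in 𝓝ˢ (closure K), η x = 1)
    {m : ℝ} (hm : m < 1) :
    ENNReal.ofReal ((1 - m) ^ 2 * harmonicCapacity K univ) ≤
      eLpNorm (fun x => η x • g x + (v x - m) • ∇ η x) 2 (volume.restrict U) ^ 2 := by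
  obtain ⟨W, hW, hKW, w, hw1, hw2, hw3, hw4⟩ := hw
  have hO : IsOpen (U ∩ W) := hU.inter hW
  obtain ⟨χ, hχ, hχc, hχO, hχ1⟩ :=
    exists_smooth_cutoff hK.isCompact_closure hO (subset_inter hKU hKW)
  -- η = χ + ξ with χ supported where w n is smooth and ξ vanishing near the closure of K, since η =
  -- χ = 1 there.
  set ξ : 𝔼 → ℝ := fun x => η x + -χ x with hξ
  have hξs : ContDiff ℝ ∞ ξ := hη.add hχ.neg
  have hξc : HasCompactSupport ξ := hηc.add hχc.neg
  have hξU : tsupport ξ ⊆ U := by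
    refine (closure_minimal (t := tsupport η ∪ tsupport χ) (fun x hx => ?_)
      ((isClosed_tsupport _).union (isClosed_tsupport _))).trans
      (union_subset hηU (hχO.trans inter_subset_left))
    by_contra h
    rw [mem_union, not_or] at h
    apply hx
    simp [hξ, image_eq_zero_of_notMem_tsupport h.1, image_eq_zero_of_notMem_tsupport h.2]
  obtain ⟨u, hu, hu1, hu2⟩ := exists_smooth_approx hU hv hξc.isCompact hξU
  have hdiff : ∀ {a : 𝔼 → ℝ}, ContDiff ℝ ∞ a → Differentiable ℝ a :=
    fun ha => ha.differentiable (by simp)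
  have hcg : ∀ {a : 𝔼 → ℝ}, ContDiff ℝ ∞ a → Continuous (∇ a) :=
    fun ha => continuous_gradient (ha.of_le (by simp))
  obtain ⟨M1, hM1⟩ := hχc.exists_bound_of_continuous hχ.continuous
  obtain ⟨M2, hM2⟩ := hξc.exists_bound_of_continuous hξs.continuous
  obtain ⟨M3, hM3⟩ := hχc.gradient.exists_bound_of_continuous (hcg hχ)
  obtain ⟨M4, hM4⟩ := hξc.gradient.exists_bound_of_continuous (hcg hξs)
  set f : ℕ → 𝔼 → ℝ := fun n x => χ x * (w n x + (1 - m)) + ξ x * (u n x + -m) with hf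
  set G : 𝔼 → 𝔼 := fun x => η x • g x + (v x - m) • ∇ η x with hG
  have hwm : ∀ n, ContDiffOn ℝ ∞ (fun x => w n x + (1 - m)) (U ∩ W) := fun n =>
    (hw1 n).add contDiffOn_const
  have hf1 : ∀ n, ContDiff ℝ ∞ (f n) := fun n =>
    (contDiff_mul_of_tsupport_subset hO hχ hχO (hwm n)).add (hξs.mul ((hu n).add contDiff_const))
  have hfc : ∀ n, HasCompactSupport (f n) := fun n => hχc.mul_right.add hξc.mul_right
  have hηg : ∀ x, ∇ η x = ∇ χ x + ∇ ξ x := fun x => by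
    rw [← gradient_add (hdiff hχ x) (hdiff hξs x)]
    congr 1
    ext y
    simp [hξ]
  -- Both w n + 1 and u n approximate v, so the gradient is that of η(v - m) plus terms tending to
  -- zero in L².
  have hfg : ∀ n x, ∇ (f n) x = G x + (χ x • (∇ (w n) x - g x) + (w n x - (v x - 1)) • ∇ χ x +
      (ξ x • (∇ (u n) x - g x) + (u n x - v x) • ∇ ξ x)) := by
    intro n x
    simp only [hf]
    rw [gradient_add (hdiff (contDiff_mul_of_tsupport_subset hO hχ hχO (hwm n)) x)
      (hdiff (hξs.mul ((hu n).add contDiff_const)) x),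
      gradient_mul_of_tsupport_subset hO hχ hχO (hwm n) x,
      gradient_mul (hdiff hξs x) (hdiff ((hu n).add contDiff_const) x), gradient_add_const,
      gradient_add_const]
    simp only [hG, hηg, hξ]
    module
  have hvm : AEStronglyMeasurable v (volume.restrict U) := hv.memLp.1
  have hgm : AEStronglyMeasurable g (volume.restrict U) := hv.memLp_grad.1
  have hGm : AEStronglyMeasurable G (volume.restrict U) :=
    (hη.continuous.aestronglyMeasurable.smul hgm).add
      ((hvm.sub aestronglyMeasurable_const).smul (hcg hη).aestronglyMeasurable)
  set D : ℕ → ℝ≥0∞ := fun n =>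
    ENNReal.ofReal M1 * eLpNorm (fun x => ∇ (w n) x - g x) 2 (volume.restrict (U ∩ W)) +
    ENNReal.ofReal M3 * eLpNorm (fun x => w n x - (v x - 1)) 2 (volume.restrict (U ∩ W)) +
    (ENNReal.ofReal M2 * eLpNorm (fun x => ∇ (u n) x - g x) 2 (volume.restrict (tsupport ξ)) +
    ENNReal.ofReal M4 * eLpNorm (fun x => u n x - v x) 2 (volume.restrict (tsupport ξ))) with hD
  have hDlim : Tendsto D atTop (𝓝 0) := by
    have h := ((ENNReal.Tendsto.const_mul (a := ENNReal.ofReal M1) hw4 (.inr (by simp))).add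
      (ENNReal.Tendsto.const_mul (a := ENNReal.ofReal M3) hw3 (.inr (by simp)))).add
      ((ENNReal.Tendsto.const_mul (a := ENNReal.ofReal M2) hu2 (.inr (by simp))).add
      (ENNReal.Tendsto.const_mul (a := ENNReal.ofReal M4) hu1 (.inr (by simp))))
    simpa using h
  have hbound : ∀ n, ENNReal.ofReal ((1 - m) ^ 2 * harmonicCapacity K univ) ≤
      (eLpNorm G 2 (volume.restrict U) + D n) ^ 2 := by
    intro n
    refine (harmonicCapacity_le (hf1 n) (hfc n) (by linarith) fun x hx => ?_).trans ?_
    · have hxcl := subset_closure hx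
      have h1 : ∀ᶠ y in 𝓝 x, y ∉ closure {x | x ∈ U ∩ W ∧ w n x ≠ 0} :=
        isClosed_closure.isOpen_compl.mem_nhds fun h => by
          have : x ∈ K ∩ closure {x | x ∈ U ∩ W ∧ w n x ≠ 0} := ⟨hx, h⟩
          rw [hw2 n] at this
          exact this
      filter_upwards [h1, hO.mem_nhds ⟨hKU hxcl, hKW hxcl⟩, hχ1.filter_mono (nhds_le_nhdsSet hxcl),
        hη1.filter_mono (nhds_le_nhdsSet hxcl)] with y hy1 hy2 hy3 hy4
      have hwy : w n y = 0 := by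
        by_contra h
        exact hy1 (subset_closure ⟨hy2, h⟩)
      simp [hf, hξ, hy3, hy4, hwy]
    gcongr
    have hsupp : ∀ x ∉ U, ∇ (f n) x = 0 := fun x hx => by
      have h1 : x ∉ tsupport χ := fun h => hx (hχO h).1
      have h2 : x ∉ tsupport ξ := fun h => hx (hξU h)
      rw [hfg, hG]
      simp only [hηg, image_eq_zero_of_notMem_tsupport h1, image_eq_zero_of_notMem_tsupport h2,
        gradient_eq_zero_of_notMem_tsupport h1, gradient_eq_zero_of_notMem_tsupport h2,
        image_eq_zero_of_notMem_tsupport (fun h => hx (hηU h))]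
      simp
    set A : 𝔼 → 𝔼 := fun x => χ x • (∇ (w n) x - g x) + (w n x - (v x - 1)) • ∇ χ x with hA
    set B : 𝔼 → 𝔼 := fun x => ξ x • (∇ (u n) x - g x) + (u n x - v x) • ∇ ξ x with hB
    have hB1 : AEStronglyMeasurable (fun x => ξ x • (∇ (u n) x - g x)) (volume.restrict U) :=
      hξs.continuous.aestronglyMeasurable.smul ((hcg (hu n)).aestronglyMeasurable.sub hgm)
    have hB2 : AEStronglyMeasurable (fun x => (u n x - v x) • ∇ ξ x) (volume.restrict U) :=
      ((hu n).continuous.aestronglyMeasurable.sub hvm).smul (hcg hξs).aestronglyMeasurable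
    have hBm : AEStronglyMeasurable B (volume.restrict U) := hB1.add hB2
    -- Since w n is smooth only on U ∩ W, measurability of A on U is read off from the gradient of
    -- the globally smooth f n.
    have hAm : AEStronglyMeasurable A (volume.restrict U) := by
      have : A = fun x => ∇ (f n) x - G x - B x := by
        ext1 x
        rw [hfg]
        simp only [hA, hB]
        abel
      rw [this]
      exact ((hcg (hf1 n)).aestronglyMeasurable.sub hGm).sub hBm
    have hO' : MeasurableSet (U ∩ W) := hO.measurableSet
    have hrO : volume.restrict (U ∩ W) ≤ volume.restrict U :=
      Measure.restrict_mono inter_subset_left le_rfl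
    have hA1 : AEStronglyMeasurable (fun x => χ x • (∇ (w n) x - g x))
        (volume.restrict (U ∩ W)) := by
      have : ContinuousOn (∇ (w n)) (U ∩ W) :=
        (InnerProductSpace.toDual ℝ _).symm.continuous.comp_continuousOn
          ((hw1 n).continuousOn_fderiv_of_isOpen hO (by simp))
      exact hχ.continuous.aestronglyMeasurable.smul
        ((this.aestronglyMeasurable hO').sub (hgm.mono_measure hrO))
    have hA2 : AEStronglyMeasurable (fun x => (w n x - (v x - 1)) • ∇ χ x)
        (volume.restrict (U ∩ W)) :=
      (((hw1 n).continuousOn.aestronglyMeasurable hO').sub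
        ((hvm.mono_measure hrO).sub aestronglyMeasurable_const)).smul
        (hcg hχ).aestronglyMeasurable
    have hχ0 : ∀ x ∉ U ∩ W, χ x = 0 := fun x hx =>
      image_eq_zero_of_notMem_tsupport fun h => hx (hχO h)
    have hχg0 : ∀ x ∉ U ∩ W, ∇ χ x = 0 := fun x hx =>
      gradient_eq_zero_of_notMem_tsupport fun h => hx (hχO h)
    have hAle : eLpNorm A 2 (volume.restrict U) ≤
        ENNReal.ofReal M1 * eLpNorm (fun x => ∇ (w n) x - g x) 2 (volume.restrict (U ∩ W)) +
        ENNReal.ofReal M3 * eLpNorm (fun x => w n x - (v x - 1)) 2 (volume.restrict (U ∩ W)) := by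
      calc eLpNorm A 2 (volume.restrict U) ≤ ENNReal.ofReal 1 *
            eLpNorm A 2 ((volume.restrict U).restrict (U ∩ W)) :=
            eLpNorm_le_mul_eLpNorm_restrict hO' (fun x => by simp)
              (fun x hx => by simp [hA, hχ0 x hx, hχg0 x hx]) 2
        _ = eLpNorm A 2 (volume.restrict (U ∩ W)) := by
            rw [ENNReal.ofReal_one, one_mul, Measure.restrict_restrict hO',
              inter_eq_left.2 inter_subset_left]
        _ ≤ _ := eLpNorm_add_le hA1 hA2 (by norm_num)
        _ ≤ _ := by
            refine add_le_add ?_ ?_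
            · refine eLpNorm_le_mul_eLpNorm_of_ae_le_mul (.of_forall fun x => ?_) 2
              rw [norm_smul]
              exact mul_le_mul_of_nonneg_right (hM1 x) (norm_nonneg _)
            · refine eLpNorm_le_mul_eLpNorm_of_ae_le_mul (.of_forall fun x => ?_) 2
              rw [norm_smul, mul_comm]
              exact mul_le_mul_of_nonneg_right (hM3 x) (norm_nonneg _)
    have hBle : eLpNorm B 2 (volume.restrict U) ≤
        ENNReal.ofReal M2 * eLpNorm (fun x => ∇ (u n) x - g x) 2 (volume.restrict (tsupport ξ)) +
        ENNReal.ofReal M4 * eLpNorm (fun x => u n x - v x) 2 (volume.restrict (tsupport ξ)) := by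
      have hts : MeasurableSet (tsupport ξ) := (isClosed_tsupport ξ).measurableSet
      have hrr : (volume.restrict U).restrict (tsupport ξ) = volume.restrict (tsupport ξ) := by
        rw [Measure.restrict_restrict hts, inter_eq_left.2 hξU]
      refine (eLpNorm_add_le hB1 hB2 (by norm_num)).trans (add_le_add ?_ ?_)
      · rw [← hrr]
        refine eLpNorm_le_mul_eLpNorm_restrict hts (fun x => ?_) (fun x hx => ?_) 2
        · rw [norm_smul]
          exact mul_le_mul_of_nonneg_right (hM2 x) (norm_nonneg _)
        · rw [image_eq_zero_of_notMem_tsupport hx, zero_smul]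
      · rw [← hrr]
        refine eLpNorm_le_mul_eLpNorm_restrict hts (fun x => ?_) (fun x hx => ?_) 2
        · rw [norm_smul, mul_comm]
          exact mul_le_mul_of_nonneg_right (hM4 x) (norm_nonneg _)
        · rw [gradient_eq_zero_of_notMem_tsupport hx, smul_zero]
    calc eLpNorm (∇ (f n)) 2 volume ≤ ENNReal.ofReal 1 * eLpNorm (∇ (f n)) 2 (volume.restrict U) :=
          eLpNorm_le_mul_eLpNorm_restrict hU.measurableSet (fun x => by simp) hsupp 2
      _ = eLpNorm (G + (A + B)) 2 (volume.restrict U) := by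
          rw [ENNReal.ofReal_one, one_mul]
          congr 1
          ext1 x
          exact hfg n x
      _ ≤ eLpNorm G 2 (volume.restrict U) + (eLpNorm A 2 (volume.restrict U) +
          eLpNorm B 2 (volume.restrict U)) :=
          (eLpNorm_add_le hGm (hAm.add hBm) (by norm_num)).trans
            (add_le_add le_rfl (eLpNorm_add_le hAm hBm (by norm_num)))
      _ ≤ _ := add_le_add le_rfl (add_le_add hAle hBle)
  have hlim : Tendsto (fun n => (eLpNorm G 2 (volume.restrict U) + D n) ^ 2) atTop
      (𝓝 (eLpNorm G 2 (volume.restrict U) ^ 2)) := by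
    simpa using ENNReal.Tendsto.pow (n := 2) (hDlim.const_add (eLpNorm G 2 (volume.restrict U)))
  exact ge_of_tendsto' hlim hbound

end Capacity

/-! ### The multiscale cutoff and its error -/

theorem norm_sum_sq_le_of_subsingleton {ι F : Type*} [NormedAddCommGroup F] (s : Finset ι)
    {f : ι → F} (hf : ∀ i ∈ s, ∀ j ∈ s, f i ≠ 0 → f j ≠ 0 → i = j) :
    ‖∑ i ∈ s, f i‖ ^ 2 ≤ ∑ i ∈ s, ‖f i‖ ^ 2 := by
  by_cases h : ∃ i ∈ s, f i ≠ 0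
  · obtain ⟨i, hi, hfi⟩ := h
    rw [Finset.sum_eq_single_of_mem i hi fun j hj hji => by
      by_contra hfj
      exact hji (hf j hj i hi hfj hfi)]
    exact Finset.single_le_sum (f := fun i => ‖f i‖ ^ 2) (fun _ _ => by positivity) hi
  · push Not at h
    rw [Finset.sum_eq_zero h]
    simpa using Finset.sum_nonneg fun _ _ => by positivity

/-- A multiscale cutoff function, the average of `n` cutoff functions living on disjoint
annuli. -/
theorem exists_multiscale_cutoff (N : ℕ) : ∃ M : ℝ, 0 < M ∧ ∀ R : ℝ, 0 < R → ∀ n : ℕ, 0 < n →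
    ∃ η : EuclideanSpace ℝ (Fin N) → ℝ, ContDiff ℝ ∞ η ∧
      tsupport η ⊆ Metric.closedBall 0 (2 * (4 ^ n * R)) ∧ (∀ x ∈ Metric.ball 0 R, η x = 1) ∧
      (∀ x, ‖η x‖ ≤ 1) ∧
      ∀ x, ‖∇ η x‖ ^ 2 ≤ ((n : ℝ) ^ 2)⁻¹ * ∑ k ∈ Finset.range n,
        (Metric.ball 0 (3 * (4 ^ k * R))).indicator (fun _ => M / (4 ^ k * R) ^ 2) x := by
  -- The rescaled bump at scale S k has gradient supported in S k ≤ |x| ≤ 2 S k. The ratio 4 between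
  -- scales makes these annuli disjoint, and the radius 3 S k gives an open ball containing the k-th
  -- one.
  let ψ : ContDiffBump (0 : EuclideanSpace ℝ (Fin N)) := ⟨1, 2, one_pos, one_lt_two⟩
  have hψ : ContDiff ℝ ∞ ψ := ψ.contDiff
  have hψd : Differentiable ℝ ψ := hψ.differentiable (by simp)
  obtain ⟨M, hM⟩ := ψ.hasCompactSupport.gradient.exists_bound_of_continuous
    (continuous_gradient (hψ.of_le (by simp)))
  refine ⟨(|M| + 1) ^ 2, by positivity, fun R hR n hn => ?_⟩
  have hn' : (0 : ℝ) < n := by exact_mod_cast hn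
  set S : ℕ → ℝ := fun k => 4 ^ k * R with hS
  have hS0 : ∀ k, 0 < S k := fun k => by positivity
  have hSm : ∀ {i j}, i ≤ j → S i ≤ S j := fun hij => by
    simp only [hS]; gcongr; norm_num
  set η : EuclideanSpace ℝ (Fin N) → ℝ := fun x =>
    (n : ℝ)⁻¹ * ∑ k ∈ Finset.range n, ψ ((S k)⁻¹ • x) with hη
  have hk : ∀ k, ContDiff ℝ ∞ fun x : EuclideanSpace ℝ (Fin N) => ψ ((S k)⁻¹ • x) := fun k =>
    hψ.comp (contDiff_const_smul _)
  have hkg : ∀ k x, ∇ (fun x : EuclideanSpace ℝ (Fin N) => ψ ((S k)⁻¹ • x)) x =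
      (S k)⁻¹ • ∇ ψ ((S k)⁻¹ • x) := fun k x => by
    refine ext_inner_right ℝ fun y => ?_
    have h := ((hψd ((S k)⁻¹ • x)).hasFDerivAt.comp x
      ((hasFDerivAt_id x).const_smul (S k)⁻¹)).fderiv
    have h2 : fderiv ℝ (fun x : EuclideanSpace ℝ (Fin N) => ψ ((S k)⁻¹ • x)) x = _ := h
    rw [inner_gradient_left, h2, inner_smul_left, inner_gradient_left]
    simp
  have hηg : ∀ x, ∇ η x = (n : ℝ)⁻¹ • ∑ k ∈ Finset.range n, (S k)⁻¹ • ∇ ψ ((S k)⁻¹ • x) := by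
    intro x
    refine ext_inner_right ℝ fun y => ?_
    have hd : ∀ k ∈ Finset.range n, DifferentiableAt ℝ
        (fun x : EuclideanSpace ℝ (Fin N) => ψ ((S k)⁻¹ • x)) x :=
      fun k _ => (hk k).differentiable (by simp) x
    simp only [hη]
    rw [inner_gradient_left, fderiv_const_mul (DifferentiableAt.fun_sum hd), fderiv_fun_sum hd]
    simp only [← hkg, smul_apply, sum_apply,
      inner_smul_left, sum_inner, inner_gradient_left, conj_trivial, smul_eq_mul]
  have hzero_out : ∀ k x, 2 * S k < ‖x‖ → ((S k)⁻¹ • x) ∉ tsupport ψ := fun k x hx => by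
    rw [ψ.tsupport_eq, mem_closedBall_zero_iff, norm_smul, norm_inv,
      Real.norm_of_nonneg (hS0 k).le, not_le, inv_mul_eq_div, lt_div_iff₀ (hS0 k)]
    exact hx
  have hg_in : ∀ k x, ‖x‖ < S k → ∇ ψ ((S k)⁻¹ • x) = 0 := fun k x hx => by
    have hmem : (S k)⁻¹ • x ∈ Metric.ball (0 : EuclideanSpace ℝ (Fin N)) 1 := by
      rw [mem_ball_zero_iff, norm_smul, norm_inv, Real.norm_of_nonneg (hS0 k).le, inv_mul_eq_div,
        div_lt_one (hS0 k)]
      exact hx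
    have : ψ =ᶠ[𝓝 ((S k)⁻¹ • x)] fun _ => 1 := by
      filter_upwards [Metric.isOpen_ball.mem_nhds hmem] with y hy
      exact ψ.one_of_mem_closedBall (Metric.ball_subset_closedBall hy)
    rw [this.gradient_eq]
    exact gradient_const _ 1
  refine ⟨η, contDiff_const.mul (ContDiff.sum fun k _ => hk k), ?_, ?_, ?_, ?_⟩
  · refine closure_minimal (fun x hx => ?_) Metric.isClosed_closedBall
    rw [mem_closedBall_zero_iff]
    by_contra! h
    apply hx
    simp only [hη]
    rw [Finset.sum_eq_zero fun k hk => ?_, mul_zero]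
    refine image_eq_zero_of_notMem_tsupport (hzero_out k x (lt_of_le_of_lt ?_ h))
    have := hSm (Finset.mem_range.1 hk).le
    linarith
  · intro x hx
    rw [mem_ball_zero_iff] at hx
    simp only [hη]
    rw [Finset.sum_congr rfl (g := fun _ => (1 : ℝ)) fun k _ => ?_]
    · simp [hn'.ne']
    · refine ψ.one_of_mem_closedBall ?_
      rw [mem_closedBall_zero_iff, norm_smul, norm_inv, Real.norm_of_nonneg (hS0 k).le,
        inv_mul_eq_div, div_le_one (hS0 k)]
      have := hSm (Nat.zero_le k)
      simp only [hS, pow_zero, one_mul] at this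
      exact hx.le.trans this
  · intro x
    have h0 : 0 ≤ ∑ k ∈ Finset.range n, ψ ((S k)⁻¹ • x) := Finset.sum_nonneg fun k _ => ψ.nonneg
    rw [Real.norm_of_nonneg (by positivity), inv_mul_le_one₀ hn']
    simpa using Finset.sum_le_card_nsmul (Finset.range n) _ 1 fun k _ => ψ.le_one
  · intro x
    rw [hηg, norm_smul, mul_pow, norm_inv, Real.norm_of_nonneg hn'.le, inv_pow]
    gcongr
    refine (norm_sum_sq_le_of_subsingleton _ ?_).trans (Finset.sum_le_sum fun k _ => ?_)
    · have key : ∀ i j, i < j → ∇ ψ ((S i)⁻¹ • x) ≠ 0 → ∇ ψ ((S j)⁻¹ • x) ≠ 0 → False := by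
        intro i j hij h1 h2
        have h3 : ‖x‖ ≤ 2 * S i := by
          by_contra! h
          exact h1 (gradient_eq_zero_of_notMem_tsupport (hzero_out i x h))
        have h4 : S j ≤ ‖x‖ := by
          by_contra! h
          exact h2 (hg_in j x h)
        have h5 : S (i + 1) ≤ S j := hSm hij
        have h6 : S (i + 1) = 4 * S i := by simp only [hS]; ring
        linarith [hS0 i]
      intro i _ j _ hi hj
      have hi' := (smul_ne_zero_iff.1 hi).2
      have hj' := (smul_ne_zero_iff.1 hj).2
      rcases lt_trichotomy i j with h | h | h
      · exact (key i j h hi' hj').elim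
      · exact h
      · exact (key j i h hj' hi').elim
    · by_cases hx : x ∈ Metric.ball 0 (3 * (4 ^ k * R))
      · rw [indicator_of_mem hx, norm_smul, mul_pow, norm_inv, Real.norm_of_nonneg (hS0 k).le,
          inv_pow, inv_mul_eq_div]
        gcongr
        exact (hM _).trans ((le_abs_self M).trans (by linarith))
      · rw [indicator_of_notMem hx, gradient_eq_zero_of_notMem_tsupport, smul_zero, norm_zero]
        · simp
        · refine hzero_out k x ?_
          rw [mem_ball_zero_iff, not_lt] at hx
          have := hS0 k
          simp only [hS] at this ⊢
          linarith

theorem eLpNorm_smul_gradient_sq_le {N n : ℕ} {η f : EuclideanSpace ℝ (Fin N) → ℝ}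
    {U : Set (EuclideanSpace ℝ (Fin N))} {ρ a : ℕ → ℝ} {c : ℝ} (hc : 0 ≤ c) (ha : ∀ k, 0 ≤ a k)
    (hη : ∀ x, ‖∇ η x‖ ^ 2 ≤ c * ∑ k ∈ Finset.range n,
      (Metric.ball 0 (ρ k)).indicator (fun _ => a k) x)
    (hf : AEMeasurable f (volume.restrict U)) :
    eLpNorm (fun x => f x • ∇ η x) 2 (volume.restrict U) ^ 2 ≤
      ENNReal.ofReal c * ∑ k ∈ Finset.range n,
        ENNReal.ofReal (a k) * ∫⁻ x in Metric.ball 0 (ρ k) ∩ U, ‖f x‖ₑ ^ 2 := by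
  have hm : ∀ k, AEMeasurable (fun x => (Metric.ball 0 (ρ k)).indicator
      (fun x => ENNReal.ofReal (a k) * ‖f x‖ₑ ^ 2) x) (volume.restrict U) := fun k =>
    ((hf.enorm.pow_const 2).const_mul _).indicator measurableSet_ball
  rw [eLpNorm_two_sq]
  calc _ ≤ ∫⁻ x in U, ENNReal.ofReal c * ∑ k ∈ Finset.range n, (Metric.ball 0 (ρ k)).indicator
        (fun x => ENNReal.ofReal (a k) * ‖f x‖ₑ ^ 2) x := by
        refine lintegral_mono fun x => ?_
        have h1 : ‖∇ η x‖ₑ ^ 2 ≤ ENNReal.ofReal c * ∑ k ∈ Finset.range n,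
            (Metric.ball 0 (ρ k)).indicator (fun _ => ENNReal.ofReal (a k)) x := by
          have h2 := ENNReal.ofReal_le_ofReal (hη x)
          rw [ENNReal.ofReal_mul hc, ENNReal.ofReal_sum_of_nonneg fun k _ =>
            indicator_nonneg (fun _ _ => ha k) x, ENNReal.ofReal_pow (norm_nonneg _),
            ofReal_norm] at h2
          refine h2.trans (le_of_eq ?_)
          congr 1
          refine Finset.sum_congr rfl fun k _ => ?_
          by_cases hx : x ∈ Metric.ball 0 (ρ k) <;> simp [hx]
        rw [enorm_smul, mul_pow]
        refine (mul_le_mul_right h1 _).trans (le_of_eq ?_)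
        rw [mul_left_comm, Finset.mul_sum]
        congr 1
        refine Finset.sum_congr rfl fun k _ => ?_
        by_cases hx : x ∈ Metric.ball 0 (ρ k)
        · rw [indicator_of_mem hx, indicator_of_mem hx, mul_comm]
        · rw [indicator_of_notMem hx, indicator_of_notMem hx, mul_zero]
    _ = _ := by
        rw [lintegral_const_mul'' _ (Finset.aemeasurable_fun_sum _ fun k _ => hm k),
          lintegral_finsetSum' _ fun k _ => hm k]
        congr 1
        refine Finset.sum_congr rfl fun k _ => ?_
        rw [lintegral_indicator measurableSet_ball, Measure.restrict_restrict measurableSet_ball,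
          lintegral_const_mul'' _ ((hf.mono_measure
            (Measure.restrict_mono inter_subset_right le_rfl)).enorm.pow_const 2)]

/-- At each scale the factor (4^k R)⁻² cancels the square of the radius in the Poincaré inequality,
leaving 536 · 3² · M = 4824 M. Summing n equal terms against n⁻² leaves 1/n. -/
theorem IsSobolevH1.eLpNorm_sub_average_smul_gradient_sq_le {l h R M : ℝ} {n : ℕ} (hR : 0 < R)
    (hM : 0 < M) (hn : 0 < n)
    {v : EuclideanSpace ℝ (Fin 3) → ℝ} {g : EuclideanSpace ℝ (Fin 3) → EuclideanSpace ℝ (Fin 3)}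
    (hv : IsSobolevH1 (solidCylinder l h) v g) {η : EuclideanSpace ℝ (Fin 3) → ℝ}
    (hη : ∀ x, ‖∇ η x‖ ^ 2 ≤ ((n : ℝ) ^ 2)⁻¹ * ∑ k ∈ Finset.range n,
        (Metric.ball 0 (3 * (4 ^ k * R))).indicator (fun _ => M / (4 ^ k * R) ^ 2) x)
    (hl : 2 * (3 * (4 ^ n * R)) ≤ l) (hh : 2 * (3 * (4 ^ n * R)) ≤ h)
    (hlog : 3 * (4 ^ n * R) * max 0 (Real.log (l / h)) ≤ h) (hlin : 3 * (4 ^ n * R) * h ≤ l ^ 2) :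
    eLpNorm (fun x => (v x - ⨍ z in solidCylinder l h, v z) • ∇ η x) 2
        (volume.restrict (solidCylinder l h)) ^ 2 ≤
      ENNReal.ofReal (4824 * M / n) * eLpNorm g 2 (volume.restrict (solidCylinder l h)) ^ 2 := by
  have hn' : (0 : ℝ) < n := by exact_mod_cast hn
  have hvm : AEMeasurable v (volume.restrict (solidCylinder l h)) := hv.memLp.1.aemeasurable
  have hh0 : 0 < h := lt_of_lt_of_le (by positivity) hh
  refine (eLpNorm_smul_gradient_sq_le (by positivity) (fun k => by positivity) hη
    (hvm.sub_const _)).trans ?_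
  calc _ ≤ ENNReal.ofReal ((n : ℝ) ^ 2)⁻¹ * ∑ k ∈ Finset.range n, ENNReal.ofReal (4824 * M) *
        eLpNorm g 2 (volume.restrict (solidCylinder l h)) ^ 2 := by
        refine mul_le_mul_right (Finset.sum_le_sum fun k hk => ?_) _
        set S : ℝ := 3 * (4 ^ k * R) with hS
        have hS0 : 0 < S := by positivity
        have hST : S ≤ 3 * (4 ^ n * R) := by
          have := (Finset.mem_range.1 hk).le
          simp only [hS]
          gcongr
          norm_num
        have hP := hv.setLIntegral_sub_average_sq_le hS0 (by linarith) (by linarith)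
          (by
            refine le_trans ?_ hlog
            calc S * Real.log (l / h) ≤ S * max 0 (Real.log (l / h)) := by
                  gcongr; exact le_max_right _ _
              _ ≤ _ := by gcongr)
          (le_trans (by gcongr) hlin)
        calc _ ≤ ENNReal.ofReal (M / (4 ^ k * R) ^ 2) * (ENNReal.ofReal (536 * S ^ 2) *
              eLpNorm g 2 (volume.restrict (solidCylinder l h)) ^ 2) := by
              gcongr
              rw [eLpNorm_two_sq]
              exact (lintegral_mono_set (inter_subset_left.trans
                (ball_subset_solidCylinder hS0.le le_rfl le_rfl))).trans hP
          _ = _ := by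
              rw [← mul_assoc, ← ENNReal.ofReal_mul (by positivity)]
              congr 2
              simp only [hS]
              field_simp
              ring
    _ = _ := by
        rw [Finset.sum_const, Finset.card_range, nsmul_eq_mul, ← ENNReal.ofReal_natCast n,
          ← mul_assoc, ← mul_assoc, ← ENNReal.ofReal_mul (by positivity),
          ← ENNReal.ofReal_mul (by positivity)]
        congr 2
        field_simp

/-! ### Choice of constants and the contradiction -/

theorem mainTheorem7 (K : Set (EuclideanSpace ℝ (Fin 3))) (hK : Bornology.IsBounded K)
    (θ : ℝ) (hθ : θ ∈ Set.Ioo (0 : ℝ) 1) :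
    ∃ L H τ c : ℝ, 0 < L ∧ 0 < H ∧ 0 < τ ∧ 0 < c ∧
      ∀ l h : ℝ, L ≤ l → H ≤ h → max (Real.log l / h) (h / l ^ 2) ≤ τ →
        ∀ (v : EuclideanSpace ℝ (Fin 3) → ℝ)
          (g : EuclideanSpace ℝ (Fin 3) → EuclideanSpace ℝ (Fin 3)),
          IsSobolevH1 (solidCylinder l h) v g →
          EqWeakly (solidCylinder l h) v g 1 K →
          ∫ x in solidCylinder l h, ‖g x‖ ^ 2 < θ * harmonicCapacity K Set.univ →
          c < ⨍ x in solidCylinder l h, v x := by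
  obtain ⟨hθ0, hθ1⟩ := hθ
  obtain ⟨M, hM, hcut⟩ := exists_multiscale_cutoff 3
  obtain ⟨R₀, hR₀⟩ := hK.subset_closedBall 0
  set R : ℝ := |R₀| + 1 with hR
  have hR1 : 1 ≤ R := by simp [hR]
  set s := Real.sqrt θ with hs
  have hs0 : 0 < s := Real.sqrt_pos.2 hθ0
  have hs1 : s < 1 := by rw [hs, Real.sqrt_lt' one_pos]; simpa using hθ1
  have hs2 : s ^ 2 = θ := Real.sq_sqrt hθ0.le
  set ε := (1 - s) / 2 with hε
  have hε0 : 0 < ε := by rw [hε]; linarith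
  -- The number of scales is chosen so that the cutoff error is at most ε times the norm of g.
  obtain ⟨n, hn⟩ := exists_nat_gt (4824 * M / ε ^ 2)
  have hn' : (0 : ℝ) < n := lt_of_le_of_lt (by positivity) hn
  have hn0 : 0 < n := by exact_mod_cast hn'
  have hnε : 4824 * M / n ≤ ε ^ 2 := by
    rw [div_lt_iff₀ (by positivity)] at hn
    rw [div_le_iff₀ hn']
    linarith
  obtain ⟨η, hη, hηs, hη1, hηle, hηg⟩ := hcut R (by linarith) n hn0
  -- T exceeds every radius at which the Poincaré inequality is used, so the conditions at scale T
  -- imply those at all smaller scales.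
  set T := 3 * (4 ^ n * R) with hT
  have h4 : (1 : ℝ) ≤ 4 ^ n := one_le_pow₀ (by norm_num)
  have hT1 : 1 ≤ T := by rw [hT]; nlinarith
  refine ⟨2 * T, 2 * T, 1 / T, ε, by linarith, by linarith, by positivity, hε0, ?_⟩
  intro l h hl hh hmax v g hv hw hE
  have hl1 : 1 ≤ l := by linarith
  have hh1 : 1 ≤ h := by linarith
  have hlog : T * Real.log l ≤ h := by
    have := (le_max_left _ _).trans hmax
    rw [div_le_div_iff₀ (by linarith) (by linarith)] at this
    linarith
  have hlin : T * h ≤ l ^ 2 := by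
    have := (le_max_right _ _).trans hmax
    rw [div_le_div_iff₀ (by positivity) (by linarith)] at this
    linarith
  have hlogmax : max 0 (Real.log (l / h)) ≤ Real.log l :=
    max_le (Real.log_nonneg hl1) (Real.log_le_log (by positivity) (div_le_self (by linarith) hh1))
  set U := solidCylinder l h with hU
  have hballU : Metric.closedBall 0 (2 * (4 ^ n * R)) ⊆ U :=
    (Metric.closedBall_subset_ball (by rw [hT] at hT1; linarith)).trans
      (ball_subset_solidCylinder (S := T) (by linarith) (by linarith) (by linarith))
  have hKR : closure K ⊆ Metric.ball 0 R :=
    (closure_minimal hR₀ Metric.isClosed_closedBall).trans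
      (Metric.closedBall_subset_ball (by rw [hR]; linarith [le_abs_self R₀]))
  have hKU : closure K ⊆ U := hKR.trans
    (ball_subset_solidCylinder (by linarith) (by nlinarith) (by nlinarith))
  by_contra! hm
  set m := ⨍ x in U, v x with hmdef
  have hcap := hv.ofReal_mul_harmonicCapacity_le (isOpen_solidCylinder l h) hK hKU hw hη
    ((isCompact_closedBall _ _).of_isClosed_subset (isClosed_tsupport _) hηs)
    (hηs.trans hballU)
    (Filter.mem_of_superset (Metric.isOpen_ball.mem_nhdsSet.2 hKR) hη1)
    (m := m) (by linarith)
  have hgrad := hv.eLpNorm_sub_average_smul_gradient_sq_le (by linarith) hM hn0 hηg hl hh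
    ((mul_le_mul_of_nonneg_left hlogmax (by linarith)).trans hlog) hlin
  set G := eLpNorm g 2 (volume.restrict U) with hG
  have hgrad' : eLpNorm (fun x => (v x - m) • ∇ η x) 2 (volume.restrict U) ≤
      ENNReal.ofReal ε * G := by
    refine (ENNReal.pow_le_pow_left_iff two_ne_zero).1 (hgrad.trans ?_)
    rw [mul_pow, ← ENNReal.ofReal_pow hε0.le]
    gcongr
  have hηgle : eLpNorm (fun x => η x • g x) 2 (volume.restrict U) ≤ G := by
    refine eLpNorm_mono fun x => ?_
    rw [norm_smul]
    exact mul_le_of_le_one_left (norm_nonneg _) (hηle x)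
  have hadd : eLpNorm (fun x => η x • g x + (v x - m) • ∇ η x) 2 (volume.restrict U) ≤
      ENNReal.ofReal (1 + ε) * G := by
    refine (eLpNorm_add_le (hη.continuous.aestronglyMeasurable.smul hv.memLp_grad.1)
      ((hv.memLp.1.sub aestronglyMeasurable_const).smul
        (continuous_gradient (hη.of_le (by simp))).aestronglyMeasurable) (by norm_num)).trans ?_
    rw [ENNReal.ofReal_add zero_le_one hε0.le, add_mul, ENNReal.ofReal_one, one_mul]
    exact add_le_add hηgle hgrad'
  have hG2 : G ^ 2 = ENNReal.ofReal (∫ x in U, ‖g x‖ ^ 2) := by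
    rw [ofReal_integral_eq_lintegral_ofReal (hv.memLp_grad.integrable_norm_pow two_ne_zero)
      (.of_forall fun x => by positivity), hG, eLpNorm_two_sq]
    refine lintegral_congr fun x => ?_
    rw [ENNReal.ofReal_pow (norm_nonneg _), ofReal_norm]
  have hI0 : 0 ≤ ∫ x in U, ‖g x‖ ^ 2 := integral_nonneg fun x => by positivity
  have hreal : (1 - m) ^ 2 * harmonicCapacity K univ ≤ (1 + ε) ^ 2 * ∫ x in U, ‖g x‖ ^ 2 := by
    rw [← ENNReal.ofReal_le_ofReal_iff (by positivity), ENNReal.ofReal_mul (p := (1 + ε) ^ 2) (by positivity), ← hG2,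
      ENNReal.ofReal_pow (by positivity), ← mul_pow]
    exact hcap.trans (by gcongr)
  -- The energy hypothesis is impossible when the capacity is zero.
  have hcap0 : 0 < harmonicCapacity K univ :=
    pos_of_mul_pos_right (hI0.trans_lt hE) hθ0.le
  have h1 : (1 - ε) ^ 2 ≤ (1 - m) ^ 2 := by
    have : 1 - ε = (1 + s) / 2 := by rw [hε]; ring
    have h2 : 0 ≤ 1 - ε := by rw [this]; positivity
    gcongr
  -- With this ε the inequality amounts to (1 - s)² ≥ 0.
  have h2 : (1 + ε) * s ≤ 1 - ε := by rw [hε]; nlinarith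
  have h3 : ((1 + ε) * s) ^ 2 ≤ (1 - ε) ^ 2 := by gcongr
  rw [mul_pow, hs2] at h3
  have h5 : (1 + ε) ^ 2 * ∫ x in U, ‖g x‖ ^ 2 < (1 + ε) ^ 2 * (θ * harmonicCapacity K univ) := by
    gcongr
  have h6 := mul_le_mul_of_nonneg_right h3 hcap0.le
  have h7 := mul_le_mul_of_nonneg_right h1 hcap0.le
  linarith
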